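/- **Notation.** Let $n\ge 1$ and let $\mathbb H^n=\mathbb C^n\times\mathbb R$ be the Heisenberg group with group law $(z,t)(w,s)=\big(z+w,\,t+s+\tfrac12\Im(z\cdot\bar w)\big)$ and Haar measure $dz\,dt$ (Lebesgue measure). For $\lambda\in\mathbb R\setminus\{0\}$ and $k\in\mathbb N=\{0,1,2,\dots\}$ let $$\varphi_{k,\lambda}^{n-1}(z)=L_k^{n-1}\big(\tfrac12|\lambda||z|^2\big)e^{-\frac14|\lambda||z|^2},\qquad e_{k,\lambda}(z,t)=e^{i\lambda t}\varphi_{k,\lambda}^{n-1}(z),\qquad d_k=\frac{(k+n-1)!}{k!\,(n-1)!},$$ where $L_k^{n-1}$ is the Laguerre polynomial of type $n-1$. Let $\Omega\subset\mathbb R^2$ (the Heisenberg fan) be the union of the rays $R_k=\{(\lambda,\tau):\tau=(2k+n)|\lambda|\}$, $k\in\mathbb N$, and $R_\infty=\{(0,\tau):\tau\ge0\}$. For $f\in L^1(\mathbb H^n)$ the normalised Strichartz Fourier transform $\widetilde f$ is the function on $\Omega\times\mathbb C^n$ given by $$\widetilde f(a,z)=\frac1{d_k}\int_{\mathbb H^n}f(w,s)\,e_{k,\lambda}\big((w,s)^{-1}(z,0)\big)\,dw\,ds,\qquad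 a=(\lambda,(2k+n)|\lambda|),\ \lambda\ne0,$$ $$\widetilde f((0,\tau),z)=(n-1)!\,2^{n-1}\int_{\mathbb H^n}f(w,s)\,\frac{J_{n-1}(\sqrt\tau|z-w|)}{(\sqrt\tau|z-w|)^{n-1}}\,dw\,ds,\qquad \tau\ge 0,$$ where $J_{n-1}$ is the Bessel function and $(n-1)!\,2^{n-1}J_{n-1}(x)/x^{n-1}$ is read as $1$ at $x=0$. Define measures on $\Omega$ by $$\int_\Omega\varphi\,d\nu_1=(2\pi)^{-2n-1}\int_{-\infty}^\infty\sum_{k=0}^\infty\varphi(\lambda,(2k+n)|\lambda|)\,d\lambda,$$ $$\int_\Omega\varphi\,d\nu_p=(2\pi)^{-2n-1}\int_{-\infty}^\infty\sum_{k=0}^\infty d_k^2\,\varphi(\lambda,(2k+n)|\lambda|)\,|\lambda|^{2n}\,d\lambda\qquad(1<p\le2).$$ **Theorem 1.4.** Let $1\le p\le 2$ and $\frac1p+\frac1{p'}=1$. There is a constant $c_{n,p}$, depending only on $n$ and $p$, such that $f\mapsto\widetilde f$ maps $L^1\cap L^p(\mathbb H^n)$ into $L^{p'}(\Omega\times\mathbb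 C^n,d\nu_p\,dw)$ and extends from $L^1\cap L^2(\mathbb H^n)$, in exactly one way, to a bounded linear operator, still denoted by $f\mapsto\widetilde f$, from $L^p(\mathbb H^n)$ to $L^{p'}(\Omega\times\mathbb C^n,d\nu_p\,dw)$. On all of $L^1\cap L^p(\mathbb H^n)$ the extension agrees almost everywhere with the integrals above, and for all $f\in L^p(\mathbb H^n)$ $$\Big(\int_\Omega\int_{\mathbb C^n}|\widetilde f(a,w)|^{p'}\,dw\,d\nu_p(a)\Big)^{1/p'}\le c_{n,p}\Big(\int_{\mathbb H^n}|f(z,t)|^p\,dz\,dt\Big)^{1/p},$$ the left side being the essential supremum of $|\widetilde f|$ with respect to $d\nu_1\,dw$ when $p=1$. -/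

import Mathlib

open MeasureTheory
open scoped ENNReal

noncomputable section

/-- The underlying manifold `ℂⁿ × ℝ` of the Heisenberg group `ℍⁿ`. Its Haar measure is the Lebesgue
measure `dz dt`, which is Mathlib's `volume` on this type. -/
abbrev Heis (n : ℕ) : Type := (Fin n → ℂ) × ℝ

/-- The group law `(z,t)(w,s) = (z + w, t + s + ½ Im (z · w̄))`. -/
def Heis.gmul {n : ℕ} (g h : Heis n) : Heis n :=
  (g.1 + h.1, g.2 + h.2 + (1 / 2) * (∑ i, g.1 i * (starRingEnd ℂ) (h.1 i)).im)

/-- The group inverse `(z,t)⁻¹ = (-z,-t)`. -/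
def Heis.ginv {n : ℕ} (g : Heis n) : Heis n := (-g.1, -g.2)

/-- The Euclidean length `|z|` of `z ∈ ℂⁿ`. -/
def cnorm {n : ℕ} (z : Fin n → ℂ) : ℝ := Real.sqrt (∑ i, ‖z i‖ ^ 2)

/-- The Laguerre polynomial `L_k^δ(t) = ∑_{j ≤ k} binom(k+δ, k-j) (-t)^j / j!` of integral type
`δ`. -/
def laguerreL (δ k : ℕ) (t : ℝ) : ℝ :=
  ∑ j ∈ Finset.range (k + 1), ((k + δ).choose (k - j) : ℝ) * (-t) ^ j / (j.factorial : ℝ)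

/-- The Laguerre function
`φ_{k,lam}^{n-1}(z) = L_k^{n-1}(½ |lam| |z|²) exp(-¼ |lam| |z|²)` on `ℂⁿ`. -/
def laguerrePhi (n k : ℕ) (lam : ℝ) (z : Fin n → ℂ) : ℝ :=
  laguerreL (n - 1) k ((1 / 2) * |lam| * cnorm z ^ 2) * Real.exp (-(1 / 4) * |lam| * cnorm z ^ 2)

/-- `e_{k,lam}^{n-1}(z,t) = exp(i lam t) φ_{k,lam}^{n-1}(z)`. -/
def laguerreE (n k : ℕ) (lam : ℝ) (g : Heis n) : ℂ :=
  Complex.exp (Complex.I * (lam * g.2 : ℝ)) * (laguerrePhi n k lam g.1 : ℂ)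

/-- The Bessel function `J_m(x) = ∑_j (-1)^j / (j! (j+m)!) (x/2)^{2j+m}` of integral order `m`. -/
def besselJ (m : ℕ) (x : ℝ) : ℝ :=
  ∑' j : ℕ, (-1) ^ j / ((j.factorial : ℝ) * ((j + m).factorial : ℝ)) * (x / 2) ^ (2 * j + m)

/-- `(n-1)! 2^{n-1} J_{n-1}(x) / x^{n-1}`, with its limiting value `1` at `x = 0`. -/
def besselNormalized (n : ℕ) (x : ℝ) : ℝ :=
  if x = 0 then 1
  else ((n - 1).factorial : ℝ) * 2 ^ (n - 1) * (besselJ (n - 1) x / x ^ (n - 1))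

/-- The Heisenberg fan `Ω`: the union of the rays `R_k = {(lam, τ) : τ = (2k+n)|lam|}`, `k ∈ ℕ`, and
of the limiting ray `R_∞ = {(0, τ) : τ ≥ 0}`. -/
def heisFan (n : ℕ) : Set (ℝ × ℝ) :=
  (⋃ k : ℕ, {a : ℝ × ℝ | a.2 = (2 * (k : ℝ) + n) * |a.1|}) ∪ {a : ℝ × ℝ | a.1 = 0 ∧ 0 ≤ a.2}

/-- The parametrization `lam ↦ (lam, (2k+n)|lam|)` of the ray `R_k ⊆ Ω`. -/
def fanRay (n k : ℕ) (lam : ℝ) : heisFan n :=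
  ⟨(lam, (2 * (k : ℝ) + n) * |lam|), Or.inl (Set.mem_iUnion.2 ⟨k, rfl⟩)⟩

/-- The index `k` of the ray `R_k` containing `a = (lam, τ)`; it is unique when `lam ≠ 0`, and this
is only used there. -/
def fanIndex (n : ℕ) (a : ℝ × ℝ) : ℕ := sInf {k : ℕ | a.2 = (2 * (k : ℝ) + n) * |a.1|}

theorem fanIndex_fanRay (n k : ℕ) {lam : ℝ} (h : lam ≠ 0) :
    fanIndex n (fanRay n k lam : ℝ × ℝ) = k := by
  have h' : |lam| ≠ 0 := abs_ne_zero.2 h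
  have : {j : ℕ | (fanRay n k lam : ℝ × ℝ).2 = (2 * (j : ℝ) + n) * |(fanRay n k lam : ℝ × ℝ).1|}
      = {k} := by
    ext j
    simp only [fanRay, Set.mem_ofPred_eq, Set.mem_singleton_iff]
    constructor
    · intro hj
      have h2 := mul_right_cancel₀ h' hj
      have h3 : (j : ℝ) = k := by linarith
      exact_mod_cast h3
    · rintro rfl
      rfl
  rw [fanIndex, this, csInf_singleton]

/-- The Strichartz Fourier transform `f̂(a,z)` of an integrable function `f` on `ℍⁿ`.
For `a = (lam, (2k+n)|lam|) ∈ R_k`, `lam ≠ 0`, it is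
`∫ f(w,s) e_{k,lam}((w,s)⁻¹(z,0)) dw ds`; for `a = (0,τ) ∈ R_∞` it is
`(n-1)! 2^{n-1} ∫ f(w,s) J_{n-1}(√τ |z-w|) / (√τ |z-w|)^{n-1} dw ds`, and in particular it is `∫ f`
for `a = (0,0)`. -/
def strichartzHat (n : ℕ) (f : Heis n → ℂ) (a : heisFan n) (z : Fin n → ℂ) : ℂ :=
  if (a : ℝ × ℝ).1 = 0 then
    ∫ g : Heis n, f g * (besselNormalized n (Real.sqrt (a : ℝ × ℝ).2 * cnorm (z - g.1)) : ℂ)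
  else
    ∫ g : Heis n, f g *
      laguerreE n (fanIndex n a) (a : ℝ × ℝ).1 (Heis.gmul (Heis.ginv g) (z, 0))

/-- The dimension factor `d_k = (k+n-1)! / (k! (n-1)!)`. -/
def fanDim (n k : ℕ) : ℝ :=
  ((k + n - 1).factorial : ℝ) / ((k.factorial : ℝ) * ((n - 1).factorial : ℝ))

/-- The normalised Strichartz Fourier transform `f̃(a,z)`: it is `f̂(a,z) / d_k` for `a ∈ R_k` off
the limiting ray, and `f̂(a,z)` on the limiting ray. -/
def strichartzTilde (n : ℕ) (f : Heis n → ℂ) (a : heisFan n) (z : Fin n → ℂ) : ℂ :=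
  if (a : ℝ × ℝ).1 = 0 then strichartzHat n f a z
  else ((fanDim n (fanIndex n a))⁻¹ : ℝ) * strichartzHat n f a z

/-- The measure on `Ω` with
`∫_Ω φ dν = ∑_k ∫_ℝ φ(lam, (2k+n)|lam|) W k lam dlam`, for a weight `W ≥ 0`. -/
def fanMeasure (n : ℕ) (W : ℕ → ℝ → ℝ) : Measure (heisFan n) :=
  Measure.sum fun k : ℕ =>
    ((volume : Measure ℝ).withDensity fun lam => ENNReal.ofReal (W k lam)).map (fanRay n k)

/-- The weight `(2π)^{-2n-1}` of the measure `ν₁`. -/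
def fanWeightOne (n : ℕ) (_k : ℕ) (_lam : ℝ) : ℝ := ((2 * Real.pi) ^ (2 * n + 1))⁻¹

/-- The weight `(2π)^{-2n-1} d_k² |lam|^{2n}` of the Plancherel measure `ν₂` of `f ↦ f̃`. -/
def fanWeightTwo (n : ℕ) (k : ℕ) (lam : ℝ) : ℝ :=
  ((2 * Real.pi) ^ (2 * n + 1))⁻¹ * fanDim n k ^ 2 * |lam| ^ (2 * n)

/-- The measures `ν_p` on `Ω`, `1 ≤ p ≤ 2`. Interpolating with change of measures between
`L¹ → L^∞(ν₁)` and `L² → L²(ν₂)`, with `1/p' = (1-θ)/∞ + θ/2`, the weight of `ν_p` is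
`W₁ ^ (p'(1-θ)/∞) * W₂ ^ (p'θ/2)`, which is `W₂` as soon as `p > 1`, since then `p'θ/2 = 1`; at the
endpoint `p = 1` the measure is `ν₁`. -/
def fanNu (n : ℕ) (p : ℝ≥0∞) : Measure (heisFan n) :=
  if p = 1 then fanMeasure n (fanWeightOne n) else fanMeasure n (fanWeightTwo n)

theorem measurable_fanRay (n k : ℕ) : Measurable (fanRay n k) := by
  refine Measurable.subtype_mk ?_
  fun_prop

theorem lintegral_fanMeasure (n : ℕ) (W : ℕ → ℝ → ℝ) (hW : ∀ k, Measurable (W k))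
    {φ : heisFan n → ℝ≥0∞} (hφ : Measurable φ) :
    ∫⁻ a, φ a ∂(fanMeasure n W)
      = ∑' k : ℕ, ∫⁻ lam : ℝ, ENNReal.ofReal (W k lam) * φ (fanRay n k lam) := by
  rw [fanMeasure, lintegral_sum_measure]
  refine tsum_congr fun k => ?_
  rw [lintegral_map hφ (measurable_fanRay n k)]
  have h := lintegral_withDensity_eq_lintegral_mul (volume : Measure ℝ) (hW k).ennreal_ofReal
    (hφ.comp (measurable_fanRay n k))
  simpa only [Function.comp_apply, Pi.mul_apply] using h

instance fanMeasure_sFinite (n : ℕ) (W : ℕ → ℝ → ℝ) : SFinite (fanMeasure n W) := by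
  unfold fanMeasure
  infer_instance

instance fanNu_sFinite (n : ℕ) (p : ℝ≥0∞) : SFinite (fanNu n p) := by
  unfold fanNu
  split_ifs <;> infer_instance

end

/-! Off the limiting ray, which is a null set, the transform is an integral operator with kernel
`e_{k,λ}((w,s)⁻¹(z,0)) / d_k`. Two bounds carry the theorem. The kernel has modulus at most `1`, so
`L¹ → L^∞` holds pointwise, hence for whatever measure on `Ω × ℂⁿ`; and there is an `L² → L²` bound
for `ν₂`. Both can therefore be used over `ν₂`, and Marcinkiewicz interpolation gives `1 < p < 2`.
Density of the simple functions gives the extension and its uniqueness.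

The kernel bound is `|L_k^{n-1}(x)| ≤ d_k exp (x / 2)`. For type `0` it comes from the
Poisson-weighted square norm of the Charlier polynomials (`hasSum_charlier_sq`): the diagonal value
at `m = k` is a multiple of `L_k(x)`, and a single term is at most the whole sum. Adding up Laguerre
polynomials raises the type.

For the `L²` bound, a Fourier transform in the central variable turns `f̃` on `R_k` into `d_k⁻¹`
times the twisted convolution of `f^λ` with `φ_{k,λ}`. The weight of `ν₂` absorbs `d_k` and `λ`, and
what remains is a Bessel inequality `∑_k ‖g ×_λ φ_{k,λ}‖² ≤ (8π²/λ²)^n ‖g‖²`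
(`tsum_lintegral_twistLaguerre_le`). The generating function `∑ r^k φ_{k,λ}` is a Gaussian for `|r|
< 1`; composing its twisted convolution with the adjoint gives a kernel of Gaussian modulus, and
Schur's test bounds the operator uniformly in `r` (`lintegral_enorm_sq_twist_laguerreGen_le`). With
`r = ρ e^{it}`, Bessel's inequality on the circle recovers the sum of squares, and `ρ → 1`. The
Plancherel inequality in the central variable follows from the same Schur test, with Gaussian
damping. -/

noncomputable section

/-! ### Charlier polynomials and the pointwise bound for Laguerre functions. -/

/-- The Charlier polynomials in the variable `m`, with parameter `x`, through their raising
relation. -/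
def charlier (x : ℝ) : ℕ → ℕ → ℝ
  | 0, _ => 1
  | k + 1, m => charlier x k m - m / x * charlier x k (m - 1)

theorem charlier_succ (x : ℝ) (k m : ℕ) :
    charlier x (k + 1) m = charlier x k m - m / x * charlier x k (m - 1) := rfl

/-- The difference operator in `m` lowers the degree. Together with the defining raising relation
this allows a summation by parts against `x ^ m / m!`. -/
theorem charlier_succ_sub {x : ℝ} (k m : ℕ) :
    charlier x (k + 1) (m + 1) = charlier x (k + 1) m - (k + 1) / x * charlier x k m := by
  induction k generalizing m with
  | zero => simp [charlier]; ring
  | succ k ih =>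
    rw [charlier_succ x (k + 1) (m + 1), ih m, charlier_succ x (k + 1) m]
    rcases m with _ | m
    · simp [charlier]; ring
    · have h1 := ih m
      have h2 := charlier_succ x k (m + 1)
      simp only [Nat.add_sub_cancel, Nat.cast_add, Nat.cast_one] at h2 ⊢
      linear_combination (k + 1) / x * h2 - (m + 1) / x * h1

/-- Any geometric growth in `m` is harmless against `x ^ m / m!`, so the factor `m` produced by the
recursion is simply absorbed in `2 ^ m`. Used for summability only. -/
theorem abs_charlier_le {x : ℝ} (hx : 0 < x) (k m : ℕ) :
    |charlier x k m| ≤ (1 + 1 / x) ^ k * (2 ^ k) ^ m := by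
  induction k generalizing m with
  | zero => simp [charlier]
  | succ k ih =>
    rw [charlier]
    have h1 := ih m
    have h2 : |(m : ℝ) / x * charlier x k (m - 1)| ≤ 1 / x * (1 + 1 / x) ^ k * (2 ^ (k + 1)) ^ m := by
      rw [abs_mul, abs_of_nonneg (by positivity)]
      have h3 := ih (m - 1)
      have h4 : (m : ℝ) ≤ 2 ^ m := by exact_mod_cast (Nat.lt_two_pow_self).le
      have h5 : ((2 : ℝ) ^ k) ^ (m - 1) ≤ (2 ^ k) ^ m :=
        pow_le_pow_right₀ (one_le_pow₀ (by norm_num)) (Nat.sub_le _ _)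
      calc (m : ℝ) / x * |charlier x k (m - 1)|
          ≤ 2 ^ m / x * ((1 + 1 / x) ^ k * (2 ^ k) ^ m) := by
            gcongr
            exact h3.trans (by gcongr)
        _ = _ := by rw [pow_succ (2 : ℝ) k, mul_pow]; ring
    calc |charlier x k m - m / x * charlier x k (m - 1)|
        ≤ |charlier x k m| + |(m : ℝ) / x * charlier x k (m - 1)| := abs_sub _ _
      _ ≤ (1 + 1 / x) ^ k * (2 ^ (k + 1)) ^ m + 1 / x * (1 + 1 / x) ^ k * (2 ^ (k + 1)) ^ m := by
          refine add_le_add (h1.trans ?_) h2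
          gcongr
          · norm_num
          · exact k.le_succ
      _ = _ := by ring

theorem summable_charlier_mul {x : ℝ} (hx : 0 < x) (j k : ℕ) :
    Summable fun m : ℕ => charlier x j m * charlier x k m * (x ^ m / m.factorial) := by
  have h := (Real.summable_pow_div_factorial (2 ^ j * 2 ^ k * x)).mul_left
    ((1 + 1 / x) ^ j * (1 + 1 / x) ^ k)
  refine Summable.of_norm_bounded h fun m => ?_
  rw [Real.norm_eq_abs, abs_mul, abs_mul, abs_of_nonneg (a := x ^ m / m.factorial) (by positivity)]
  calc |charlier x j m| * |charlier x k m| * (x ^ m / m.factorial)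
      ≤ ((1 + 1 / x) ^ j * (2 ^ j) ^ m) * ((1 + 1 / x) ^ k * (2 ^ k) ^ m)
          * (x ^ m / m.factorial) := by
        gcongr
        · exact abs_charlier_le hx _ _
        · exact abs_charlier_le hx _ _
    _ = _ := by rw [mul_pow, mul_pow]; ring

/-- Replace one factor of degree `k + 1` by the recursion and shift `m`. The cross sum `a` of
degrees `k + 1` and `k` then occurs twice with opposite signs and cancels, so its value
(orthogonality) is never needed. -/
theorem hasSum_charlier_sq {x : ℝ} (hx : 0 < x) (k : ℕ) :
    HasSum (fun m : ℕ => charlier x k m * charlier x k m * (x ^ m / m.factorial))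
      (k.factorial / x ^ k * Real.exp x) := by
  induction k with
  | zero =>
    simpa [charlier, Real.exp_eq_exp_ℝ] using NormedSpace.expSeries_div_hasSum_exp (𝔸 := ℝ) x
  | succ k ih =>
    obtain ⟨a, ha⟩ := summable_charlier_mul hx (k + 1) k
    have hB : HasSum (fun m : ℕ => charlier x (k + 1) m * (m / x * charlier x k (m - 1))
        * (x ^ m / m.factorial)) (a - (k + 1) / x * (k.factorial / x ^ k * Real.exp x)) := by
      -- The term `m = 0` vanishes because of the factor `m`; the shift turns `m * x ^ m / m!` into
      -- `x * x ^ (m - 1) / (m - 1)!`.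
      rw [← hasSum_nat_add_iff' 1]
      simp only [Finset.range_one, Finset.sum_singleton, Nat.cast_zero, zero_div, zero_mul,
        mul_zero, sub_zero]
      convert! ha.sub (ih.mul_left ((k + 1) / x)) using 2 with m
      rw [charlier_succ_sub, Nat.factorial_succ, Nat.add_sub_cancel]
      push_cast
      have : (m.factorial : ℝ) ≠ 0 := by positivity
      have : (m + 1 : ℝ) ≠ 0 := by positivity
      field_simp
      ring
    convert! ha.sub hB using 1
    · funext m
      rw [charlier]
      ring
    · rw [Nat.factorial_succ]
      push_cast
      field_simp
      ring

theorem charlier_eq_sum {x : ℝ} (k m : ℕ) :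
    charlier x k m
      = ∑ j ∈ Finset.range (k + 1), (k.choose j : ℝ) * (-1 / x) ^ j * (m.descFactorial j : ℝ) := by
  induction k generalizing m with
  | zero => simp [charlier]
  | succ k ih =>
    rw [charlier, ih, ih, Finset.sum_range_succ' _ (k + 1), Finset.sum_range_succ' _ k]
    have h1 : ∀ j ∈ Finset.range (k + 1), (((k + 1).choose (j + 1) : ℕ) : ℝ) * (-1 / x) ^ (j + 1)
          * (m.descFactorial (j + 1) : ℝ)
        = (k.choose (j + 1) : ℝ) * (-1 / x) ^ (j + 1) * (m.descFactorial (j + 1) : ℝ)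
          - m / x * ((k.choose j : ℝ) * (-1 / x) ^ j * ((m - 1).descFactorial j : ℝ)) := by
      intro j _
      have : (m.descFactorial (j + 1) : ℝ) = m * ((m - 1).descFactorial j : ℝ) := by
        rcases m with _ | m
        · simp
        · rw [Nat.succ_descFactorial_succ]; push_cast; simp
      rw [Nat.choose_succ_succ, this]
      push_cast
      ring
    have h2 : ∑ j ∈ Finset.range (k + 1),
          (k.choose (j + 1) : ℝ) * (-1 / x) ^ (j + 1) * (m.descFactorial (j + 1) : ℝ)
        = ∑ j ∈ Finset.range k,
          (k.choose (j + 1) : ℝ) * (-1 / x) ^ (j + 1) * (m.descFactorial (j + 1) : ℝ) := by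
      rw [Finset.sum_range_succ]
      simp
    rw [Finset.sum_congr rfl h1, Finset.sum_sub_distrib, ← Finset.mul_sum, h2]
    simp
    ring

/-- Charlier and Laguerre polynomials are dual: the explicit Charlier sum at `m = k`, read in
reverse order, is the Laguerre sum. -/
theorem charlier_self {x : ℝ} (hx : 0 < x) (k : ℕ) :
    charlier x k k = k.factorial * (-1 / x) ^ k * laguerreL 0 k x := by
  rw [charlier_eq_sum, laguerreL, Finset.mul_sum, ← Finset.sum_range_reflect]
  refine Finset.sum_congr rfl fun j hj => ?_
  have hj : j ≤ k := by simpa [Nat.lt_succ_iff] using hj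
  obtain ⟨i, rfl⟩ := Nat.exists_eq_add_of_le hj
  have h1 : j + i + 1 - 1 - j = i := by omega
  have h2 : j + i - j = i := by omega
  rw [h1, h2, add_zero]
  have h3 : ((j + i).descFactorial i : ℝ) * j.factorial = (j + i).factorial := by
    have := Nat.factorial_mul_descFactorial (n := j + i) (k := i) (by omega)
    rw [Nat.add_sub_cancel] at this
    rw [← this]; push_cast; ring
  have h4 : (j.factorial : ℝ) ≠ 0 := by positivity
  have h5 : (-1 / x) ^ j * (-x) ^ j = 1 := by
    rw [← mul_pow]; field_simp; simp
  rw [pow_add, ← h3]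
  have h6 := mul_inv_cancel₀ h4
  linear_combination (-(((j + i).choose i : ℝ) * (-1 / x) ^ i * ((j + i).descFactorial i : ℝ)
    * (j.factorial * (j.factorial : ℝ)⁻¹))) * h5
    - ((j + i).choose i : ℝ) * (-1 / x) ^ i * ((j + i).descFactorial i : ℝ) * h6

/-- The classical bound `|L_k(x)| ≤ exp (x / 2)` for the Laguerre polynomials of type `0`. -/
theorem abs_laguerreL_zero_le {x : ℝ} (hx : 0 ≤ x) (k : ℕ) :
    |laguerreL 0 k x| ≤ Real.exp (x / 2) := by
  rcases hx.eq_or_lt with rfl | hx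
  · rw [laguerreL, Finset.sum_range_succ']
    simp
  -- Of the series of nonnegative terms only the one with `m = k` is kept.
  have h1 := le_hasSum (hasSum_charlier_sq hx k) k fun m _ =>
    mul_nonneg (mul_self_nonneg _) (by positivity)
  rw [charlier_self hx] at h1
  have h2 : (-1 / x) ^ k * (-1 / x) ^ k * x ^ k * x ^ k = 1 := by
    rw [← mul_pow, ← mul_pow, ← mul_pow]; field_simp; simp
  have h3 : (0 : ℝ) < k.factorial := by positivity
  have h4 : laguerreL 0 k x ^ 2 ≤ Real.exp (x / 2) ^ 2 := by
    have h5 : Real.exp (x / 2) ^ 2 = Real.exp x := by rw [← Real.exp_nat_mul]; congr 1; push_cast; ring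
    rw [h5]
    have h6 : (k.factorial : ℝ) * (-1 / x) ^ k * laguerreL 0 k x
        * (k.factorial * (-1 / x) ^ k * laguerreL 0 k x) * (x ^ k / k.factorial)
        = k.factorial / x ^ k * laguerreL 0 k x ^ 2 := by
      have hxk : x ^ k ≠ 0 := by positivity
      field_simp
      linear_combination (laguerreL 0 k x ^ 2) * h2
    rw [h6] at h1
    exact le_of_mul_le_mul_left h1 (by positivity)
  exact abs_le_of_sq_le_sq h4 (by positivity)

/-- Pascal's rule in each coefficient. It transports the bound for type `0` to every type, the
constants adding up to a binomial coefficient. -/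
theorem laguerreL_succ_eq_sum (δ k : ℕ) (x : ℝ) :
    laguerreL (δ + 1) k x = ∑ j ∈ Finset.range (k + 1), laguerreL δ j x := by
  induction k with
  | zero => simp [laguerreL]
  | succ k ih =>
    rw [Finset.sum_range_succ, ← ih, laguerreL, laguerreL, laguerreL, Finset.sum_range_succ,
      Finset.sum_range_succ _ (k + 1), ← add_assoc (∑ j ∈ Finset.range (k + 1), _),
      ← Finset.sum_add_distrib]
    congr 1
    · refine Finset.sum_congr rfl fun j hj => ?_
      have hj : j ≤ k := by simpa [Nat.lt_succ_iff] using hj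
      obtain ⟨i, rfl⟩ := Nat.exists_eq_add_of_le hj
      have h1 : j + i + 1 - j = i + 1 := by omega
      have h2 : j + i - j = i := by omega
      have h3 : j + i + 1 + (δ + 1) = (j + i + (δ + 1)) + 1 := by ring
      have h4 : j + i + 1 + δ = j + i + (δ + 1) := by ring
      rw [h1, h2, h3, h4, Nat.choose_succ_succ]
      push_cast
      ring
    · simp

theorem sum_range_choose_add (δ k : ℕ) :
    ∑ j ∈ Finset.range (k + 1), (j + δ).choose j = (k + (δ + 1)).choose k := by
  induction k with
  | zero => simp
  | succ k ih =>
    rw [Finset.sum_range_succ, ih]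
    have h3 : k + 1 + (δ + 1) = (k + (δ + 1)) + 1 := by ring
    have h4 : k + 1 + δ = k + (δ + 1) := by ring
    rw [h3, h4, Nat.choose_succ_succ]

theorem abs_laguerreL_le {x : ℝ} (hx : 0 ≤ x) (δ k : ℕ) :
    |laguerreL δ k x| ≤ (k + δ).choose k * Real.exp (x / 2) := by
  induction δ generalizing k with
  | zero => simpa using abs_laguerreL_zero_le hx k
  | succ δ ih =>
    rw [laguerreL_succ_eq_sum, ← sum_range_choose_add, Nat.cast_sum, Finset.sum_mul]
    exact (Finset.abs_sum_le_sum_abs _ _).trans (Finset.sum_le_sum fun j _ => ih j)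

theorem fanDim_eq_choose {n : ℕ} (hn : 1 ≤ n) (k : ℕ) :
    fanDim n k = (k + (n - 1)).choose k := by
  rw [fanDim, Nat.add_sub_assoc hn, Nat.cast_add_choose]

/-- With `x = ½ |lam| |z|²` the growth `exp (x / 2)` of the Laguerre polynomial is exactly cancelled
by the Gaussian. Division by `d_k` therefore leaves a kernel bounded by `1`. -/
theorem abs_laguerrePhi_le {n : ℕ} (hn : 1 ≤ n) (k : ℕ) (lam : ℝ) (z : Fin n → ℂ) :
    |laguerrePhi n k lam z| ≤ fanDim n k := by
  have hx : 0 ≤ (1 / 2) * |lam| * cnorm z ^ 2 := by positivity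
  rw [laguerrePhi, abs_mul, Real.abs_exp, fanDim_eq_choose hn]
  refine (mul_le_mul_of_nonneg_right (abs_laguerreL_le hx (n - 1) k) (Real.exp_nonneg _)).trans ?_
  rw [mul_assoc, ← Real.exp_add]
  refine le_of_eq ?_
  rw [show (1 / 2) * |lam| * cnorm z ^ 2 / 2 + -(1 / 4) * |lam| * cnorm z ^ 2 = 0 by ring]
  simp

theorem norm_laguerreE_le {n : ℕ} (hn : 1 ≤ n) (k : ℕ) (lam : ℝ) (g : Heis n) :
    ‖laguerreE n k lam g‖ ≤ fanDim n k := by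
  rw [laguerreE, norm_mul, mul_comm Complex.I, Complex.norm_exp_ofReal_mul_I, one_mul,
    Complex.norm_real]
  exact abs_laguerrePhi_le hn k lam g.1

/-! ### Generating functions. -/

/-- The generating function of the Laguerre polynomials. -/
theorem hasSum_laguerreL (δ : ℕ) (x : ℝ) {r : ℂ} (hr : ‖r‖ < 1) :
    HasSum (fun k : ℕ => r ^ k * (laguerreL δ k x : ℂ))
      (1 / (1 - r) ^ (δ + 1) * Complex.exp (-x * r / (1 - r))) := by
  have h1r : (1 - r) ≠ 0 := by
    intro h
    have : r = 1 := (sub_eq_zero.1 h).symm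
    simp [this] at hr
  -- Summed over the second index `F` is a negative binomial series, then over the first an
  -- exponential series; summed along the antidiagonal of `k` it is `r ^ k * L_k(x)`.
  let F : ℕ × ℕ → ℂ := fun q =>
    (((q.2 + (q.1 + δ)).choose (q.1 + δ) : ℕ) : ℂ) * r ^ q.2 * ((-x * r) ^ q.1 / q.1.factorial)
  have hinner : ∀ (s : ℂ) (_ : ‖s‖ < 1) (y : ℂ) (j : ℕ), HasSum (fun m : ℕ =>
      (((m + (j + δ)).choose (j + δ) : ℕ) : ℂ) * s ^ m * (y ^ j / j.factorial))
      (1 / (1 - s) ^ (δ + 1) * ((y / (1 - s)) ^ j / j.factorial)) := by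
    intro s hs y j
    convert! (hasSum_choose_mul_geometric_of_norm_lt_one (j + δ) hs).mul_right (y ^ j / j.factorial)
      using 1
    rw [div_pow, show j + δ + 1 = (δ + 1) + j by ring, pow_add _ (δ + 1) j]
    simp only [div_eq_mul_inv, mul_inv]
    ring
  have houter : ∀ (s : ℂ) (y : ℂ), HasSum (fun j : ℕ =>
      (1 / (1 - s) ^ (δ + 1) * ((y / (1 - s)) ^ j / j.factorial)))
      (1 / (1 - s) ^ (δ + 1) * Complex.exp (y / (1 - s))) := by
    intro s y
    have := NormedSpace.expSeries_div_hasSum_exp (𝔸 := ℂ) (y / (1 - s))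
    rw [← Complex.exp_eq_exp_ℂ] at this
    exact this.mul_left _
  have hsumm : Summable F := by
    -- The norms of the terms form a double series of the same shape, with `‖r‖` and `‖x r‖`, so the
    -- same row sums give absolute summability.
    have hnr : ‖(‖r‖ : ℂ)‖ < 1 := by simpa using hr
    refine Summable.of_norm ?_
    rw [summable_prod_of_nonneg (fun _ => norm_nonneg _)]
    have key : ∀ j, HasSum (fun m => ‖F (j, m)‖)
        (1 / (1 - ‖r‖) ^ (δ + 1) * ((‖(-x * r)‖ / (1 - ‖r‖)) ^ j / j.factorial)) := by
      intro j
      have h := hinner (‖r‖ : ℂ) hnr (‖(-x * r)‖ : ℂ) j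
      have h2 : ∀ m, (((m + (j + δ)).choose (j + δ) : ℕ) : ℂ) * (‖r‖ : ℂ) ^ m
        * ((‖(-x * r)‖ : ℂ) ^ j / j.factorial) = ((‖F (j, m)‖ : ℝ) : ℂ) := by
        intro m
        simp [F]
      simp only [h2] at h
      rw [← Complex.hasSum_ofReal]
      convert h using 1
      push_cast
      rfl
    refine ⟨fun j => (key j).summable, ?_⟩
    simp only [fun j => (key j).tsum_eq]
    exact (Real.summable_pow_div_factorial _).mul_left _
  have hF : HasSum F (1 / (1 - r) ^ (δ + 1) * Complex.exp (-x * r / (1 - r))) := by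
    have h1 := hsumm.hasSum.prod_fiberwise (fun j => hinner r hr (-x * r) j)
    have h2 := h1.unique (houter r (-x * r))
    exact h2 ▸ hsumm.hasSum
  have hG := (Finset.HasAntidiagonal.sigmaAntidiagonalEquivProd.hasSum_iff (f := F)).2 hF
  have h3 := hG.sigma (fun k => hasSum_fintype _)
  convert! h3 using 2 with k
  rw [Finset.sum_coe_sort_eq_attach (Finset.HasAntidiagonal.antidiagonal k)
    (fun q => (F ∘ Finset.HasAntidiagonal.sigmaAntidiagonalEquivProd) ⟨k, q⟩)]
  have h4 : ∑ q ∈ (Finset.HasAntidiagonal.antidiagonal k).attach,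
      (F ∘ Finset.HasAntidiagonal.sigmaAntidiagonalEquivProd) ⟨k, q⟩
      = ∑ q ∈ Finset.HasAntidiagonal.antidiagonal k, F q := by
    rw [← Finset.sum_attach (Finset.HasAntidiagonal.antidiagonal k)]
    rfl
  rw [h4, Finset.Nat.sum_antidiagonal_eq_sum_range_succ_mk, laguerreL]
  push_cast
  rw [Finset.mul_sum]
  refine Finset.sum_congr rfl fun j hj => ?_
  have hj : j ≤ k := by simpa [Nat.lt_succ_iff] using hj
  obtain ⟨i, rfl⟩ := Nat.exists_eq_add_of_le hj
  have h2 : j + i - j = i := by omega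
  simp only [F, h2]
  rw [show j + i + δ = i + (j + δ) by ring, Nat.choose_symm_add, pow_add, mul_pow]
  ring

/-- The generating function of the Laguerre functions `φ_{k,lam}`. -/
theorem hasSum_laguerrePhi {n : ℕ} (hn : 1 ≤ n) (lam : ℝ) (z : Fin n → ℂ) {r : ℂ} (hr : ‖r‖ < 1) :
    HasSum (fun k : ℕ => r ^ k * (laguerrePhi n k lam z : ℂ))
      (1 / (1 - r) ^ n *
        Complex.exp (-(|lam| / 4 * ((1 + r) / (1 - r)) * (cnorm z ^ 2 : ℝ)))) := by
  have h1r : (1 - r) ≠ 0 := by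
    intro h
    have : r = 1 := (sub_eq_zero.1 h).symm
    simp [this] at hr
  have h := (hasSum_laguerreL (n - 1) ((1 / 2) * |lam| * cnorm z ^ 2) hr).mul_right
    (Complex.exp ((-(1 / 4) * |lam| * cnorm z ^ 2 : ℝ)))
  rw [Nat.sub_add_cancel hn, mul_assoc (1 / (1 - r) ^ n), ← Complex.exp_add] at h
  convert! h using 2
  · rw [laguerrePhi]
    push_cast
    ring
  · congr 2
    push_cast
    field_simp
    ring

/-! ### Two `L²` tools: Schur's test for the composition with the adjoint, and Bessel's inequality
on the circle. -/

/-- An `L²` bound for an integral operator `g ↦ ∫ g w * k z w` through Schur's test for the kernel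
`∫ k z w * conj (k z w')` of its composition with its adjoint. -/
theorem lintegral_enorm_sq_integral_mul_kernel_le {Z α : Type*} [MeasurableSpace Z]
    [MeasurableSpace α] {μ : Measure Z} {ν : Measure α} [SFinite μ] [SFinite ν]
    {k : Z → α → ℂ} (hk : Measurable (Function.uncurry k)) {M : ℝ≥0∞} (hM : M ≠ ∞)
    (hdom : ∀ w w', ∫⁻ z, ‖k z w‖ₑ * ‖k z w'‖ₑ ∂μ ≤ M) {H : α → α → ℝ≥0∞}
    (hH : Measurable (Function.uncurry H)) (hsymm : ∀ w w', H w w' = H w' w) {C : ℝ≥0∞}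
    (hC : ∀ w, ∫⁻ w', H w w' ∂ν ≤ C)
    (hK : ∀ w w', ‖∫ z, k z w * (starRingEnd ℂ) (k z w') ∂μ‖ₑ ≤ H w w')
    {g : α → ℂ} (hgm : Measurable g) (hg : Integrable g ν) :
    ∫⁻ z, ‖∫ w, g w * k z w ∂ν‖ₑ ^ 2 ∂μ ≤ C * ∫⁻ w, ‖g w‖ₑ ^ 2 ∂ν := by
  let F : Z × (α × α) → ℂ := fun q =>
    (g q.2.1 * k q.1 q.2.1) * (starRingEnd ℂ) (g q.2.2 * k q.1 q.2.2)
  have hk1 : Measurable fun q : Z × (α × α) => k q.1 q.2.1 :=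
    hk.comp (measurable_fst.prodMk (measurable_fst.comp measurable_snd))
  have hk2 : Measurable fun q : Z × (α × α) => k q.1 q.2.2 :=
    hk.comp (measurable_fst.prodMk (measurable_snd.comp measurable_snd))
  have hg1 : Measurable fun q : Z × (α × α) => g q.2.1 :=
    hgm.comp (measurable_fst.comp measurable_snd)
  have hg2 : Measurable fun q : Z × (α × α) => g q.2.2 :=
    hgm.comp (measurable_snd.comp measurable_snd)
  have hFm : Measurable F :=
    (hg1.mul hk1).mul (Complex.continuous_conj.measurable.comp (hg2.mul hk2))
  -- `M` is used only here, to justify Fubini; it does not enter the final constant.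
  have hFi : Integrable F (μ.prod (ν.prod ν)) := by
    refine ⟨hFm.aestronglyMeasurable, ?_⟩
    rw [hasFiniteIntegral_iff_enorm, lintegral_prod_symm _ hFm.enorm.aemeasurable]
    have h1 : ∀ y : α × α, ∫⁻ z, ‖F (z, y)‖ₑ ∂μ ≤ M * (‖g y.1‖ₑ * ‖g y.2‖ₑ) := by
      intro y
      have h2 : ∀ z, ‖F (z, y)‖ₑ = ‖g y.1‖ₑ * ‖g y.2‖ₑ * (‖k z y.1‖ₑ * ‖k z y.2‖ₑ) := by
        intro z
        simp only [F, enorm_mul, RCLike.enorm_conj]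
        ring
      simp only [h2]
      rw [lintegral_const_mul' _ _ (by finiteness), mul_comm]
      gcongr
      exact hdom _ _
    refine (lintegral_mono h1).trans_lt ?_
    rw [lintegral_const_mul' _ _ hM, lintegral_prod_mul hgm.enorm.aemeasurable
      hgm.enorm.aemeasurable]
    exact ENNReal.mul_lt_top hM.lt_top (ENNReal.mul_lt_top hg.2 hg.2)
  have hT : ∀ z, ∫ y, F (z, y) ∂(ν.prod ν) = ((‖∫ w, g w * k z w ∂ν‖ ^ 2 : ℝ) : ℂ) := by
    intro z
    have h := integral_prod_mul (μ := ν) (ν := ν) (fun w => g w * k z w)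
      (fun w => (starRingEnd ℂ) (g w * k z w))
    rw [integral_conj, Complex.mul_conj, Complex.normSq_eq_norm_sq] at h
    exact h
  have hTi : Integrable (fun z => ‖∫ w, g w * k z w ∂ν‖ ^ 2) μ := by
    have h := hFi.integral_prod_left
    simp only [hT] at h
    exact h.re
  have h1 : ∫⁻ z, ‖∫ w, g w * k z w ∂ν‖ₑ ^ 2 ∂μ = ‖∫ y, ∫ z, F (z, y) ∂μ ∂(ν.prod ν)‖ₑ := by
    rw [← integral_integral_swap hFi]
    simp only [hT]
    rw [integral_complex_ofReal, ← ofReal_norm, Complex.norm_real, Real.norm_of_nonneg (by positivity),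
      ofReal_integral_eq_lintegral_ofReal hTi (Filter.Eventually.of_forall fun _ => by positivity)]
    refine lintegral_congr fun z => ?_
    rw [ENNReal.ofReal_pow (norm_nonneg _), ofReal_norm]
  rw [h1]
  -- Schur's test with the inequality `|a b| ≤ (|a|² + |b|²) / 2`; by symmetry of `H` the two halves
  -- have equal integrals.
  have h2 : ∀ y : α × α, ‖∫ z, F (z, y) ∂μ‖ₑ
      ≤ 2⁻¹ * (‖g y.1‖ₑ ^ 2 * H y.1 y.2 + ‖g y.2‖ₑ ^ 2 * H y.2 y.1) := by
    intro y
    have h3 : ∀ z, F (z, y) = g y.1 * (starRingEnd ℂ) (g y.2)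
        * (k z y.1 * (starRingEnd ℂ) (k z y.2)) := by
      intro z
      simp only [F, map_mul]
      ring
    simp only [h3]
    rw [integral_const_mul, enorm_mul, enorm_mul, RCLike.enorm_conj, hsymm y.2 y.1, ← add_mul,
      ← mul_assoc]
    refine mul_le_mul' ?_ (hK _ _)
    rw [← ofReal_norm, ← ofReal_norm, ← ENNReal.ofReal_mul (norm_nonneg _),
      ← ENNReal.ofReal_pow (norm_nonneg _), ← ENNReal.ofReal_pow (norm_nonneg _),
      ← ENNReal.ofReal_add (by positivity) (by positivity),
      show (2⁻¹ : ℝ≥0∞) = ENNReal.ofReal 2⁻¹ by rw [ENNReal.ofReal_inv_of_pos two_pos]; simp,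
      ← ENNReal.ofReal_mul (by positivity)]
    refine ENNReal.ofReal_le_ofReal ?_
    nlinarith [sq_nonneg (‖g y.1‖ - ‖g y.2‖)]
  have hP : Measurable fun y : α × α => ‖g y.1‖ₑ ^ 2 * H y.1 y.2 :=
    ((hgm.comp measurable_fst).enorm.pow_const 2).mul hH
  have hA : ∫⁻ y : α × α, ‖g y.1‖ₑ ^ 2 * H y.1 y.2 ∂(ν.prod ν) ≤ C * ∫⁻ w, ‖g w‖ₑ ^ 2 ∂ν := by
    rw [lintegral_prod _ hP.aemeasurable,
      mul_comm C, ← lintegral_mul_const _ (hgm.enorm.pow_const 2)]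
    refine lintegral_mono fun w => ?_
    simp only
    rw [lintegral_const_mul' _ _ (by finiteness)]
    gcongr
    exact hC w
  have hB : ∫⁻ y : α × α, ‖g y.2‖ₑ ^ 2 * H y.2 y.1 ∂(ν.prod ν) ≤ C * ∫⁻ w, ‖g w‖ₑ ^ 2 ∂ν := by
    refine le_of_eq_of_le ?_ hA
    exact lintegral_prod_swap (μ := ν) (ν := ν) (fun y : α × α => ‖g y.1‖ₑ ^ 2 * H y.1 y.2)
  calc ‖∫ y, ∫ z, F (z, y) ∂μ ∂(ν.prod ν)‖ₑ
      ≤ ∫⁻ y, ‖∫ z, F (z, y) ∂μ‖ₑ ∂(ν.prod ν) := enorm_integral_le_lintegral_enorm _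
    _ ≤ ∫⁻ y : α × α, 2⁻¹ * (‖g y.1‖ₑ ^ 2 * H y.1 y.2 + ‖g y.2‖ₑ ^ 2 * H y.2 y.1) ∂(ν.prod ν) :=
        lintegral_mono h2
    _ = 2⁻¹ * (∫⁻ y : α × α, ‖g y.1‖ₑ ^ 2 * H y.1 y.2 ∂(ν.prod ν)
        + ∫⁻ y : α × α, ‖g y.2‖ₑ ^ 2 * H y.2 y.1 ∂(ν.prod ν)) := by
        rw [lintegral_const_mul' _ _ (by simp), lintegral_add_left hP]
    _ ≤ 2⁻¹ * (C * ∫⁻ w, ‖g w‖ₑ ^ 2 ∂ν + C * ∫⁻ w, ‖g w‖ₑ ^ 2 ∂ν) := by gcongr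
    _ = C * ∫⁻ w, ‖g w‖ₑ ^ 2 ∂ν := by
        rw [← two_mul, ← mul_assoc, ENNReal.inv_mul_cancel (by simp) (by simp), one_mul]

/-- Bessel's inequality on the circle for an absolutely convergent power series. -/
theorem tsum_enorm_sq_le_lintegral_fourier {c : ℕ → ℂ} (hc : Summable fun k => ‖c k‖) :
    ∑' k, ‖c k‖ₑ ^ 2 ≤ ∫⁻ t : UnitAddCircle, ‖∑' k : ℕ, c k * fourier (k : ℤ) t‖ₑ ^ 2
      ∂AddCircle.haarAddCircle := by
  have hs : Summable fun k : ℕ => c k • (fourier (k : ℤ) : C(UnitAddCircle, ℂ)) := by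
    refine Summable.of_norm ?_
    simpa [norm_smul, fourier_norm] using hc
  set F : C(UnitAddCircle, ℂ) := ∑' k : ℕ, c k • (fourier (k : ℤ) : C(UnitAddCircle, ℂ)) with hF
  set f := ContinuousMap.toLp (E := ℂ) 2 (AddCircle.haarAddCircle (T := (1 : ℝ))) ℂ F with hf
  have hL : HasSum (fun k : ℕ => c k • (fourierLp (T := (1 : ℝ)) 2 (k : ℤ))) f := by
    have h := hs.hasSum.mapL (ContinuousMap.toLp (E := ℂ) 2
      (AddCircle.haarAddCircle (T := (1 : ℝ))) ℂ)
    simpa only [map_smul] using h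
  have hin : ∀ m : ℕ, inner ℂ (fourierLp (T := (1 : ℝ)) 2 (m : ℤ)) f = c m := by
    intro m
    have h := hL.mapL (innerSL ℂ (fourierLp (T := (1 : ℝ)) 2 (m : ℤ)))
    simp only [innerSL_apply_apply, inner_smul_right] at h
    have h2 := hasSum_ite_eq m (c m)
    refine h.unique ?_
    convert! h2 using 2 with k
    have := orthonormal_iff_ite.1 (orthonormal_fourier (T := (1 : ℝ))) (m : ℤ) (k : ℤ)
    rw [this]
    by_cases hkm : k = m
    · simp [hkm]
    · have : ¬ m = k := fun h => hkm h.symm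
      simp [hkm, this]
  have hnorm : ‖f‖ₑ ^ 2 = ∫⁻ t : UnitAddCircle, ‖∑' k : ℕ, c k * fourier (k : ℤ) t‖ₑ ^ 2
      ∂AddCircle.haarAddCircle := by
    rw [Lp.enorm_def, eLpNorm_congr_ae (ContinuousMap.coeFn_toLp (𝕜 := ℂ) _ F),
      eLpNorm_eq_lintegral_rpow_enorm_toReal (by simp) (by simp), ← ENNReal.rpow_natCast,
      ← ENNReal.rpow_mul]
    simp only [ENNReal.toReal_ofNat, Nat.cast_ofNat, one_div, ne_eq, OfNat.ofNat_ne_zero,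
      not_false_eq_true, inv_mul_cancel₀, ENNReal.rpow_one, ENNReal.rpow_ofNat]
    refine lintegral_congr fun t => ?_
    rw [hF, ← ContinuousMap.tsum_apply hs]
    simp
  rw [← hnorm, ENNReal.tsum_eq_iSup_sum]
  refine iSup_le fun s => ?_
  have hon : Orthonormal ℂ fun m : ℕ => fourierLp (T := (1 : ℝ)) 2 (m : ℤ) :=
    orthonormal_fourier.comp _ Nat.cast_injective
  have h := hon.sum_inner_products_le f (s := s)
  simp only [hin] at h
  rw [← ofReal_norm, ← ENNReal.ofReal_pow (norm_nonneg _)]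
  refine le_trans (le_of_eq ?_) (ENNReal.ofReal_le_ofReal h)
  rw [ENNReal.ofReal_sum_of_nonneg fun _ _ => by positivity]
  refine Finset.sum_congr rfl fun k _ => ?_
  rw [ENNReal.ofReal_pow (norm_nonneg _), ofReal_norm]

/-! ### Gaussian integrals on `ℂⁿ` and twisted convolution with the generating function. -/

theorem cnorm_sq {n : ℕ} (z : Fin n → ℂ) : cnorm z ^ 2 = ∑ i, ‖z i‖ ^ 2 :=
  Real.sq_sqrt (Finset.sum_nonneg fun _ _ => by positivity)

theorem continuous_cnorm {n : ℕ} : Continuous (cnorm : (Fin n → ℂ) → ℝ) := by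
  unfold cnorm
  fun_prop

@[fun_prop]
theorem measurable_cnorm {n : ℕ} : Measurable (cnorm : (Fin n → ℂ) → ℝ) :=
  continuous_cnorm.measurable

theorem integral_cexp_neg_mul_cnorm_sq_add {n : ℕ} {b : ℝ} (hb : 0 < b) (ξ : Fin n → ℂ) :
    ∫ z : Fin n → ℂ, Complex.exp (-b * (cnorm z ^ 2 : ℝ)
        + Complex.I * ((∑ i, inner ℝ (ξ i) (z i) : ℝ) : ℂ))
      = (((Real.pi / b) ^ n * Real.exp (-(cnorm ξ ^ 2 / (4 * b))) : ℝ) : ℂ) := by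
  have h1 : ∀ z : Fin n → ℂ, Complex.exp (-b * (cnorm z ^ 2 : ℝ)
        + Complex.I * ((∑ i, inner ℝ (ξ i) (z i) : ℝ) : ℂ))
      = ∏ i, Complex.exp (-(b : ℂ) * ‖z i‖ ^ 2 + Complex.I * (inner ℝ (ξ i) (z i) : ℝ)) := by
    intro z
    rw [← Complex.exp_sum, cnorm_sq, Finset.sum_add_distrib, ← Finset.mul_sum, ← Finset.mul_sum]
    push_cast
    rfl
  simp only [h1]
  rw [integral_fintype_prod_volume_eq_prod
    (fun i (v : ℂ) => Complex.exp (-(b : ℂ) * ‖v‖ ^ 2 + Complex.I * (inner ℝ (ξ i) v : ℝ)))]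
  have h2 : ∀ i, ∫ v : ℂ, Complex.exp (-(b : ℂ) * ‖v‖ ^ 2 + Complex.I * (inner ℝ (ξ i) v : ℝ))
      = (((Real.pi / b) * Real.exp (-(‖ξ i‖ ^ 2 / (4 * b))) : ℝ) : ℂ) := by
    intro i
    rw [GaussianFourier.integral_cexp_neg_mul_sq_norm_add (by simpa using hb)]
    rw [Complex.finrank_real_complex]
    simp [neg_div]
  simp only [h2]
  rw [← Complex.ofReal_prod, Finset.prod_mul_distrib, ← Real.exp_sum, cnorm_sq]
  simp [Finset.sum_div, div_pow]

theorem integrable_exp_neg_mul_cnorm_sq {n : ℕ} {b : ℝ} (hb : 0 < b) :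
    Integrable fun z : Fin n → ℂ => Real.exp (-b * cnorm z ^ 2) := by
  have h := integral_cexp_neg_mul_cnorm_sq_add hb (0 : Fin n → ℂ)
  simp only [Pi.zero_apply, inner_zero_left, Finset.sum_const_zero, Complex.ofReal_zero, mul_zero,
    add_zero] at h
  have h2 : Integrable fun z : Fin n → ℂ => Complex.exp (-b * (cnorm z ^ 2 : ℝ)) := by
    refine Integrable.of_integral_ne_zero ?_
    rw [h]
    norm_cast
    positivity
  refine h2.re.congr (Filter.Eventually.of_forall fun z => ?_)
  simp only [RCLike.re_eq_complex_re]
  rw [← Complex.ofReal_neg, ← Complex.ofReal_mul, Complex.exp_ofReal_re]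

theorem lintegral_exp_neg_mul_cnorm_sq {n : ℕ} {b : ℝ} (hb : 0 < b) :
    ∫⁻ z : Fin n → ℂ, ENNReal.ofReal (Real.exp (-b * cnorm z ^ 2))
      = ENNReal.ofReal ((Real.pi / b) ^ n) := by
  rw [← ofReal_integral_eq_lintegral_ofReal (integrable_exp_neg_mul_cnorm_sq hb)
    (Filter.Eventually.of_forall fun _ => (Real.exp_pos _).le)]
  congr 1
  have h := integral_cexp_neg_mul_cnorm_sq_add hb (0 : Fin n → ℂ)
  have h0 : cnorm (0 : Fin n → ℂ) ^ 2 = 0 := by simp [cnorm_sq]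
  simp only [Pi.zero_apply, inner_zero_left, Finset.sum_const_zero, Complex.ofReal_zero, mul_zero,
    add_zero, h0, zero_div, neg_zero, Real.exp_zero, mul_one] at h
  have h3 : ∀ z : Fin n → ℂ, Complex.exp (-b * (cnorm z ^ 2 : ℝ))
      = ((Real.exp (-b * cnorm z ^ 2) : ℝ) : ℂ) := by
    intro z; push_cast; rfl
  simp only [h3] at h
  rw [integral_complex_ofReal] at h
  exact_mod_cast h

/-- The oscillating factor of the twisted convolution with parameter `lam`. -/
def twistPhase {n : ℕ} (lam : ℝ) (z w : Fin n → ℂ) : ℂ :=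
  Complex.exp (((-(lam / 2) * (∑ i, w i * (starRingEnd ℂ) (z i)).im : ℝ) : ℂ) * Complex.I)

theorem norm_twistPhase {n : ℕ} (lam : ℝ) (z w : Fin n → ℂ) : ‖twistPhase lam z w‖ = 1 :=
  Complex.norm_exp_ofReal_mul_I _

theorem measurable_twistPhase {n : ℕ} :
    Measurable fun q : ℝ × (Fin n → ℂ) × (Fin n → ℂ) => twistPhase q.1 q.2.1 q.2.2 := by
  have : Continuous fun q : ℝ × (Fin n → ℂ) × (Fin n → ℂ) => twistPhase q.1 q.2.1 q.2.2 := by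
    unfold twistPhase
    fun_prop
  exact this.measurable

/-- The sum of the generating function `∑ r ^ k φ_{k,lam}(z)`. -/
def laguerreGen (n : ℕ) (lam : ℝ) (r : ℂ) (z : Fin n → ℂ) : ℂ :=
  1 / (1 - r) ^ n * Complex.exp (-(|lam| / 4 * ((1 + r) / (1 - r)) * (cnorm z ^ 2 : ℝ)))

theorem measurable_laguerreGen (n : ℕ) (lam : ℝ) :
    Measurable fun q : ℂ × (Fin n → ℂ) => laguerreGen n lam q.1 q.2 := by
  unfold laguerreGen
  have h : Measurable fun q : ℂ × (Fin n → ℂ) => ((cnorm q.2 ^ 2 : ℝ) : ℂ) :=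
    Complex.measurable_ofReal.comp ((measurable_cnorm.comp measurable_snd).pow_const 2)
  have h1 : Measurable fun q : ℂ × (Fin n → ℂ) => q.1 := measurable_fst
  exact (measurable_const.div ((measurable_const.sub h1).pow_const n)).mul
    (((measurable_const.mul ((measurable_const.add h1).div (measurable_const.sub h1))).mul
      h).neg.cexp)

theorem one_sub_ne_zero_of_norm_lt_one {r : ℂ} (hr : ‖r‖ < 1) : 1 - r ≠ 0 := by
  intro h
  have : r = 1 := (sub_eq_zero.1 h).symm
  simp [this] at hr

/-- The Cayley transform maps the unit disc to the right half plane, so `laguerreGen` decays like a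
Gaussian. -/
theorem re_cayley_pos {r : ℂ} (hr : ‖r‖ < 1) : 0 < ((1 + r) / (1 - r)).re := by
  have h1 : 0 < Complex.normSq (1 - r) := Complex.normSq_pos.2 (one_sub_ne_zero_of_norm_lt_one hr)
  have h2 : ‖r‖ ^ 2 < 1 := by
    have := norm_nonneg r
    nlinarith
  rw [← Complex.normSq_eq_norm_sq, Complex.normSq_apply] at h2
  rw [Complex.div_re, ← add_div]
  refine div_pos ?_ h1
  simp
  nlinarith

theorem norm_laguerreGen (n : ℕ) (lam : ℝ) (r : ℂ) (z : Fin n → ℂ) :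
    ‖laguerreGen n lam r z‖ = (‖1 - r‖ ^ n)⁻¹
      * Real.exp (-(|lam| / 4 * ((1 + r) / (1 - r)).re) * cnorm z ^ 2) := by
  rw [laguerreGen, norm_mul, norm_div, norm_one, norm_pow, one_div, Complex.norm_exp]
  congr 2
  rw [show ((|lam| : ℝ) : ℂ) / 4 * ((1 + r) / (1 - r)) * (cnorm z ^ 2 : ℝ)
    = ((|lam| / 4 * cnorm z ^ 2 : ℝ) : ℂ) * ((1 + r) / (1 - r)) by push_cast; ring,
    Complex.neg_re, Complex.re_ofReal_mul]
  ring

/-- The exact size of the kernel of the composition of the twisted convolution with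
`∑ r ^ k φ_{k,lam}` and its adjoint: a Gaussian in `w - w'`. -/
theorem norm_integral_twist_laguerreGen {n : ℕ} {lam : ℝ} (hlam : lam ≠ 0) {r : ℂ} (hr : ‖r‖ < 1)
    (w w' : Fin n → ℂ) :
    ‖∫ z, (twistPhase lam z w * laguerreGen n lam r (z - w))
        * (starRingEnd ℂ) (twistPhase lam z w' * laguerreGen n lam r (z - w'))‖
      = (‖1 - r‖ ^ n)⁻¹ ^ 2 * (2 * Real.pi / (|lam| * ((1 + r) / (1 - r)).re)) ^ n
        * Real.exp (-(|lam| * (‖(1 + r) / (1 - r)‖ ^ 2 + 1) / (8 * ((1 + r) / (1 - r)).re))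
          * cnorm (w - w') ^ 2) := by
  set A := (1 + r) / (1 - r) with hA
  have hA0 : 0 < A.re := re_cayley_pos hr
  have hl0 : 0 < |lam| := abs_pos.2 hlam
  -- After translation by the midpoint `m` the real quadratic part is centred at `0`. What is left
  -- is a Fourier integral of a Gaussian at frequency `ξ`, a multiple of the half difference `h`:
  -- the part with `A.im` comes from the complex exponents of the two Gaussians, the part with `lam
  -- * I` from the twist. The remaining dependence on `m` is a phase.
  let m : Fin n → ℂ := fun i => (w i + w' i) / 2
  let h : Fin n → ℂ := fun i => (w i - w' i) / 2
  let ξ : Fin n → ℂ := fun i => (((|lam| * A.im : ℝ) : ℂ) + lam * Complex.I) * h i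
  have hξ : cnorm ξ ^ 2 = lam ^ 2 * (A.im ^ 2 + 1) * cnorm h ^ 2 := by
    rw [cnorm_sq, cnorm_sq, Finset.mul_sum]
    refine Finset.sum_congr rfl fun i _ => ?_
    simp only [ξ, norm_mul, mul_pow]
    congr 1
    rw [← Complex.normSq_eq_norm_sq, Complex.normSq_add_mul_I, mul_pow, sq_abs]
    ring
  have hww : cnorm (w - w') ^ 2 = 4 * cnorm h ^ 2 := by
    rw [cnorm_sq, cnorm_sq, Finset.mul_sum]
    refine Finset.sum_congr rfl fun i _ => ?_
    simp only [h, Pi.sub_apply, norm_div, div_pow]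
    norm_num
    ring
  have hb : 0 < |lam| * A.re / 2 := by positivity
  have key : ∀ u : Fin n → ℂ,
      (twistPhase lam (u + m) w * laguerreGen n lam r (u + m - w))
        * (starRingEnd ℂ) (twistPhase lam (u + m) w' * laguerreGen n lam r (u + m - w'))
      = ((((‖1 - r‖ ^ n)⁻¹ ^ 2 * Real.exp (-(|lam| * A.re / 2) * cnorm h ^ 2) : ℝ) : ℂ)
          * Complex.exp (((-lam * ∑ i, (h i * (starRingEnd ℂ) (m i)).im : ℝ) : ℂ) * Complex.I))
        * Complex.exp (-((|lam| * A.re / 2 : ℝ) : ℂ) * (cnorm u ^ 2 : ℝ)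
          + Complex.I * ((∑ i, inner ℝ (ξ i) (u i) : ℝ) : ℂ)) := by
    intro u
    have hN : ((‖1 - r‖ ^ n)⁻¹ ^ 2 : ℝ) = Complex.normSq (1 / (1 - r) ^ n) := by
      rw [Complex.normSq_eq_norm_sq, norm_div, norm_pow, norm_one, one_div]
    have hX : (∑ i, w i * (starRingEnd ℂ) ((u + m) i)).im
        - (∑ i, w' i * (starRingEnd ℂ) ((u + m) i)).im
        = 2 * (∑ i, (h i * (starRingEnd ℂ) (u i)).im + ∑ i, (h i * (starRingEnd ℂ) (m i)).im) := by
      rw [Complex.im_sum, Complex.im_sum, ← Finset.sum_sub_distrib, ← Finset.sum_add_distrib,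
        Finset.mul_sum]
      refine Finset.sum_congr rfl fun i _ => ?_
      simp [h, m]
      ring
    have hP : cnorm (u + m - w) ^ 2 + cnorm (u + m - w') ^ 2
        = 2 * (cnorm u ^ 2 + cnorm h ^ 2) := by
      simp only [cnorm_sq]
      rw [← Finset.sum_add_distrib, ← Finset.sum_add_distrib, Finset.mul_sum]
      refine Finset.sum_congr rfl fun i _ => ?_
      simp only [← Complex.normSq_eq_norm_sq, Complex.normSq_apply]
      simp [h, m]
      ring
    have hQ : cnorm (u + m - w') ^ 2 - cnorm (u + m - w) ^ 2
        = 4 * ∑ i, (u i * (starRingEnd ℂ) (h i)).re := by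
      simp only [cnorm_sq]
      rw [← Finset.sum_sub_distrib, Finset.mul_sum]
      refine Finset.sum_congr rfl fun i _ => ?_
      simp only [← Complex.normSq_eq_norm_sq, Complex.normSq_apply]
      simp [h, m, -map_div₀, -map_sub]
      ring
    have hR : ∑ i, inner ℝ (ξ i) (u i) = |lam| * A.im * ∑ i, (u i * (starRingEnd ℂ) (h i)).re
        - lam * ∑ i, (h i * (starRingEnd ℂ) (u i)).im := by
      rw [Finset.mul_sum, Finset.mul_sum, ← Finset.sum_sub_distrib]
      refine Finset.sum_congr rfl fun i _ => ?_
      simp [ξ, Complex.inner, h, -map_div₀, -map_sub]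
      ring
    have hAc : (starRingEnd ℂ) A = (A.re : ℂ) - A.im * Complex.I := by
      apply Complex.ext <;> simp
    have hre : ∀ a b c d e f : ℂ, Complex.exp a * (e * Complex.exp b)
        * (Complex.exp c * (f * Complex.exp d)) = (e * f) * Complex.exp (a + b + (c + d)) := by
      intro a b c d e f
      rw [Complex.exp_add, Complex.exp_add, Complex.exp_add]
      ring
    rw [hN, Complex.ofReal_mul, ← Complex.mul_conj, Complex.ofReal_exp]
    simp only [twistPhase, laguerreGen, map_mul, ← Complex.exp_conj, ← hA]
    rw [hre, mul_assoc (1 / (1 - r) ^ n * _), mul_assoc (1 / (1 - r) ^ n * _), ← Complex.exp_add,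
      ← Complex.exp_add]
    congr 2
    simp only [map_neg, map_mul, Complex.conj_ofReal, Complex.conj_I, map_div₀, map_ofNat, hR]
    generalize (∑ i, w i * (starRingEnd ℂ) ((u + m) i)).im = X at *
    generalize (∑ i, w' i * (starRingEnd ℂ) ((u + m) i)).im = X' at *
    generalize cnorm (u + m - w) ^ 2 = P at *
    generalize cnorm (u + m - w') ^ 2 = Q at *
    generalize ∑ i, (u i * (starRingEnd ℂ) (h i)).re = R at *
    generalize ∑ i, (h i * (starRingEnd ℂ) (u i)).im = V at *
    obtain rfl : X = X' + 2 * (V + ∑ i, (h i * (starRingEnd ℂ) (m i)).im) := by linarith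
    obtain rfl : P = (cnorm u ^ 2 + cnorm h ^ 2) - 2 * R := by linarith
    obtain rfl : Q = (cnorm u ^ 2 + cnorm h ^ 2) + 2 * R := by linarith
    rw [hAc]
    push_cast
    linear_combination (-((|lam| : ℝ) : ℂ) / 4 * ((cnorm u : ℂ) ^ 2 + (cnorm h : ℂ) ^ 2 - 2 * R))
      * (Complex.re_add_im A).symm
  rw [← integral_add_right_eq_self _ m]
  simp only [key]
  rw [integral_const_mul, integral_cexp_neg_mul_cnorm_sq_add hb, norm_mul, norm_mul,
    Complex.norm_exp_ofReal_mul_I, mul_one, Complex.norm_real, Complex.norm_real,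
    Real.norm_of_nonneg (by positivity), Real.norm_of_nonneg (by positivity), hξ, hww]
  have e1 : Real.pi / (|lam| * A.re / 2) = 2 * Real.pi / (|lam| * A.re) := by field_simp
  have e2 : Real.exp (-(|lam| * (‖A‖ ^ 2 + 1) / (8 * A.re)) * (4 * cnorm h ^ 2))
      = Real.exp (-(|lam| * A.re / 2) * cnorm h ^ 2)
        * Real.exp (-(lam ^ 2 * (A.im ^ 2 + 1) * cnorm h ^ 2 / (4 * (|lam| * A.re / 2)))) := by
    rw [← Real.exp_add, ← Complex.normSq_eq_norm_sq, Complex.normSq_apply, ← sq_abs lam]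
    congr 1
    field_simp
    ring
  rw [e1, e2]
  ring

attribute [irreducible] twistPhase laguerreGen

theorem measurable_twist_laguerreGen (n : ℕ) (lam : ℝ) :
    Measurable fun q : ℂ × (Fin n → ℂ) × (Fin n → ℂ) =>
      twistPhase lam q.2.1 q.2.2 * laguerreGen n lam q.1 (q.2.1 - q.2.2) := by
  have h2 : Measurable fun q : ℂ × (Fin n → ℂ) × (Fin n → ℂ) => (q.1, q.2.1 - q.2.2) :=
    measurable_fst.prodMk ((measurable_fst.comp measurable_snd).sub
      (measurable_snd.comp measurable_snd))
  have h3 : Measurable fun q : ℂ × (Fin n → ℂ) × (Fin n → ℂ) => twistPhase lam q.2.1 q.2.2 := by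
    have : Continuous fun q : ℂ × (Fin n → ℂ) × (Fin n → ℂ) => twistPhase lam q.2.1 q.2.2 := by
      unfold twistPhase
      fun_prop
    exact this.measurable
  have h4 : Measurable fun q : ℂ × (Fin n → ℂ) × (Fin n → ℂ) =>
      laguerreGen n lam q.1 (q.2.1 - q.2.2) :=
    (measurable_laguerreGen n lam).comp h2
  exact h3.mul h4

/-- Twisted convolution with `∑ r ^ k φ_{k,lam}` is bounded on `L²`, uniformly for `‖r‖ < 1`. -/
theorem lintegral_enorm_sq_twist_laguerreGen_le {n : ℕ} {lam : ℝ} (hlam : lam ≠ 0) {r : ℂ}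
    (hr : ‖r‖ < 1) {g : (Fin n → ℂ) → ℂ} (hgm : Measurable g) (hg : Integrable g) :
    ∫⁻ z, ‖∫ w, g w * (twistPhase lam z w * laguerreGen n lam r (z - w))‖ₑ ^ 2
      ≤ ENNReal.ofReal ((8 * Real.pi ^ 2 / lam ^ 2) ^ n) * ∫⁻ w, ‖g w‖ₑ ^ 2 := by
  have hl0 : 0 < |lam| := abs_pos.2 hlam
  have hA0 := re_cayley_pos hr
  have h1r : 0 < ‖1 - r‖ := norm_pos_iff.2 (one_sub_ne_zero_of_norm_lt_one hr)
  set A := (1 + r) / (1 - r) with hA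
  set D : ℝ := (‖1 - r‖ ^ n)⁻¹ ^ 2 * (2 * Real.pi / (|lam| * A.re)) ^ n with hD
  set B : ℝ := |lam| * (‖A‖ ^ 2 + 1) / (8 * A.re) with hB
  have hB0 : 0 < B := by positivity
  have hb : 0 < |lam| / 4 * A.re := by positivity
  have hmeas : Measurable (Function.uncurry fun z w : Fin n → ℂ =>
      twistPhase lam z w * laguerreGen n lam r (z - w)) :=
    (measurable_twist_laguerreGen n lam).comp measurable_prodMk_left
  have hnk : ∀ z w, ‖twistPhase lam z w * laguerreGen n lam r (z - w)‖ₑ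
      = ENNReal.ofReal (‖1 - r‖ ^ n)⁻¹
        * ENNReal.ofReal (Real.exp (-(|lam| / 4 * A.re) * cnorm (z - w) ^ 2)) := by
    intro z w
    rw [← ofReal_norm, norm_mul, norm_twistPhase, one_mul, norm_laguerreGen,
      ENNReal.ofReal_mul (by positivity)]
  have hle : ∀ z w, ‖twistPhase lam z w * laguerreGen n lam r (z - w)‖ₑ
      ≤ ENNReal.ofReal (‖1 - r‖ ^ n)⁻¹ := by
    intro z w
    rw [hnk]
    refine mul_le_of_le_one_right' ?_
    rw [← ENNReal.ofReal_one]
    refine ENNReal.ofReal_le_ofReal (Real.exp_le_one_iff.2 ?_)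
    have := sq_nonneg (cnorm (z - w))
    nlinarith
  refine lintegral_enorm_sq_integral_mul_kernel_le hmeas
    (M := ENNReal.ofReal (‖1 - r‖ ^ n)⁻¹ * (ENNReal.ofReal (‖1 - r‖ ^ n)⁻¹
      * ENNReal.ofReal ((Real.pi / (|lam| / 4 * A.re)) ^ n))) (by finiteness) ?_
    (H := fun w w' => ENNReal.ofReal D * ENNReal.ofReal (Real.exp (-B * cnorm (w - w') ^ 2)))
    ?_ ?_ ?_ ?_ hgm hg
  · intro w w'
    calc ∫⁻ z, ‖twistPhase lam z w * laguerreGen n lam r (z - w)‖ₑ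
          * ‖twistPhase lam z w' * laguerreGen n lam r (z - w')‖ₑ
        ≤ ∫⁻ z, ENNReal.ofReal (‖1 - r‖ ^ n)⁻¹ * (ENNReal.ofReal (‖1 - r‖ ^ n)⁻¹
          * ENNReal.ofReal (Real.exp (-(|lam| / 4 * A.re) * cnorm (z - w') ^ 2))) := by
          refine lintegral_mono fun z => ?_
          exact mul_le_mul' (hle z w) (hnk z w').le
      _ = _ := by
          rw [lintegral_const_mul' _ _ (by finiteness), lintegral_const_mul' _ _ (by finiteness),
            lintegral_sub_right_eq_self (fun z : Fin n → ℂ =>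
              ENNReal.ofReal (Real.exp (-(|lam| / 4 * A.re) * cnorm z ^ 2))) w',
            lintegral_exp_neg_mul_cnorm_sq hb]
  · exact measurable_const.mul (((measurable_const.mul ((measurable_cnorm.comp
      (measurable_fst.sub measurable_snd)).pow_const 2)).exp).ennreal_ofReal)
  · intro w w'
    simp only [cnorm_sq, Pi.sub_apply]
    simp only [norm_sub_rev]
  · intro w
    have h1 : ∀ w', cnorm (w - w') ^ 2 = cnorm (w' - w) ^ 2 := by
      intro w'
      simp only [cnorm_sq, Pi.sub_apply, norm_sub_rev]
    simp only [h1]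
    rw [lintegral_const_mul' _ _ (by finiteness), lintegral_sub_right_eq_self
      (fun z : Fin n → ℂ => ENNReal.ofReal (Real.exp (-B * cnorm z ^ 2))) w,
      lintegral_exp_neg_mul_cnorm_sq hB0, ← ENNReal.ofReal_mul (by positivity)]
    refine ENNReal.ofReal_le_ofReal ?_
    -- Why the bound is uniform in `r`: the singular factor `‖1 - r‖` combines with `A` into `‖1 +
    -- r‖² + ‖1 - r‖²`, a quantity that is at least `2`. It tends to `4` as `‖r‖ → 1`; using only
    -- `2` costs a factor `2 ^ n`.
    have h2 : ‖1 - r‖ ^ 2 * (‖A‖ ^ 2 + 1) = 2 * (1 + ‖r‖ ^ 2) := by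
      have h3 : ‖1 - r‖ ^ 2 * ‖A‖ ^ 2 = ‖1 + r‖ ^ 2 := by
        rw [hA, norm_div]
        field_simp
      rw [mul_add, h3, mul_one]
      simp only [← Complex.normSq_eq_norm_sq, Complex.normSq_apply]
      simp
      ring
    have h4 : D * (Real.pi / B) ^ n
        = (16 * Real.pi ^ 2 / (|lam| ^ 2 * (‖1 - r‖ ^ 2 * (‖A‖ ^ 2 + 1)))) ^ n := by
      rw [hD, hB, inv_pow, ← pow_mul, mul_comm n 2, pow_mul, ← inv_pow, ← mul_pow, ← mul_pow]
      congr 1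
      field_simp
      ring
    rw [h4, h2, sq_abs]
    refine pow_le_pow_left₀ (by positivity) ?_ n
    rw [div_le_div_iff₀ (by positivity) (by positivity)]
    have : 0 ≤ ‖r‖ ^ 2 * (Real.pi ^ 2 * lam ^ 2) := by positivity
    nlinarith
  · intro w w'
    rw [← ofReal_norm, norm_integral_twist_laguerreGen hlam hr, ← hA, ← hD, ← hB,
      ENNReal.ofReal_mul (by positivity)]

/-! ### The Bessel inequality for the special Hermite expansion. -/

@[fun_prop]
theorem measurable_laguerrePhi (n k : ℕ) (lam : ℝ) : Measurable (laguerrePhi n k lam) := by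
  have h : Continuous (laguerrePhi n k lam) := by
    have := continuous_cnorm (n := n)
    unfold laguerrePhi laguerreL
    fun_prop
  exact h.measurable

theorem measurable_twistPhase_left {n : ℕ} (lam : ℝ) :
    Measurable fun q : (Fin n → ℂ) × (Fin n → ℂ) => twistPhase lam q.1 q.2 :=
  measurable_twistPhase.comp measurable_prodMk_left

/-- The twisted convolution `g ×_lam φ_{k,lam}`. -/
def twistLaguerre (n k : ℕ) (lam : ℝ) (g : (Fin n → ℂ) → ℂ) (z : Fin n → ℂ) : ℂ :=
  ∫ w, g w * (twistPhase lam z w * (laguerrePhi n k lam (z - w) : ℂ))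

theorem measurable_twist_laguerrePhi (n k : ℕ) (lam : ℝ) :
    Measurable fun q : (Fin n → ℂ) × (Fin n → ℂ) =>
      twistPhase lam q.1 q.2 * (laguerrePhi n k lam (q.1 - q.2) : ℂ) :=
  (measurable_twistPhase_left lam).mul (Complex.measurable_ofReal.comp
    ((measurable_laguerrePhi n k lam).comp (measurable_fst.sub measurable_snd)))

theorem measurable_twistLaguerre (n k : ℕ) (lam : ℝ) {g : (Fin n → ℂ) → ℂ} (hgm : Measurable g) :
    Measurable (twistLaguerre n k lam g) := by
  have h : StronglyMeasurable fun q : (Fin n → ℂ) × (Fin n → ℂ) =>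
      g q.2 * (twistPhase lam q.1 q.2 * (laguerrePhi n k lam (q.1 - q.2) : ℂ)) :=
    ((hgm.comp measurable_snd).mul (measurable_twist_laguerrePhi n k lam)).stronglyMeasurable
  exact h.integral_prod_right.measurable

theorem norm_twist_laguerrePhi_le {n : ℕ} (hn : 1 ≤ n) (k : ℕ) (lam : ℝ) (z w : Fin n → ℂ) :
    ‖twistPhase lam z w * (laguerrePhi n k lam (z - w) : ℂ)‖ ≤ fanDim n k := by
  rw [norm_mul, norm_twistPhase, one_mul, Complex.norm_real]
  exact abs_laguerrePhi_le hn k lam _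

theorem summable_fanDim_mul_pow {n : ℕ} (hn : 1 ≤ n) {ρ : ℝ} (h0 : 0 ≤ ρ) (h1 : ρ < 1) :
    Summable fun k => fanDim n k * ρ ^ k := by
  have h := summable_choose_mul_geometric_of_norm_lt_one (R := ℝ) (n - 1) (r := ρ)
    (by rwa [Real.norm_of_nonneg h0])
  refine h.congr fun k => ?_
  rw [fanDim_eq_choose hn, Nat.choose_symm_add]

theorem integrable_mul_twist_laguerrePhi {n : ℕ} (hn : 1 ≤ n) (k : ℕ) (lam : ℝ)
    {g : (Fin n → ℂ) → ℂ} (hg : Integrable g) (z : Fin n → ℂ) :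
    Integrable fun w => g w * (twistPhase lam z w * (laguerrePhi n k lam (z - w) : ℂ)) := by
  refine hg.mul_bdd (c := fanDim n k) ?_ ?_
  · exact ((measurable_twist_laguerrePhi n k lam).comp
      measurable_prodMk_left).aestronglyMeasurable
  · exact Filter.Eventually.of_forall fun w => norm_twist_laguerrePhi_le hn k lam z w

theorem norm_twistLaguerre_le {n : ℕ} (hn : 1 ≤ n) (k : ℕ) (lam : ℝ)
    {g : (Fin n → ℂ) → ℂ} (hg : Integrable g) (z : Fin n → ℂ) :
    ‖twistLaguerre n k lam g z‖ ≤ fanDim n k * ∫ w, ‖g w‖ := by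
  rw [twistLaguerre, mul_comm, ← integral_mul_const]
  refine norm_integral_le_of_norm_le (hg.norm.mul_const _) (Filter.Eventually.of_forall fun w => ?_)
  rw [norm_mul]
  gcongr
  exact norm_twist_laguerrePhi_le hn k lam z w

/-- Sum and integral may be interchanged because the terms are dominated by `d_k ‖r‖ ^ k ‖g‖₁`,
which is summable. -/
theorem hasSum_pow_mul_twistLaguerre {n : ℕ} (hn : 1 ≤ n) (lam : ℝ)
    {g : (Fin n → ℂ) → ℂ} (hg : Integrable g) (z : Fin n → ℂ) {r : ℂ} (hr : ‖r‖ < 1) :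
    HasSum (fun k => r ^ k * twistLaguerre n k lam g z)
      (∫ w, g w * (twistPhase lam z w * laguerreGen n lam r (z - w))) := by
  have h := hasSum_integral_of_summable_integral_norm (μ := volume)
    (F := fun k w => r ^ k * (g w * (twistPhase lam z w * (laguerrePhi n k lam (z - w) : ℂ))))
    (fun k => (integrable_mul_twist_laguerrePhi hn k lam hg z).const_mul _) ?_
  · convert! h using 2 with k
    · rw [integral_const_mul, twistLaguerre]
    · funext w
      have h2 := (hasSum_laguerrePhi hn lam (z - w) hr).mul_left (g w * twistPhase lam z w)
      rw [← laguerreGen.eq_def] at h2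
      rw [← mul_assoc, ← h2.tsum_eq]
      refine tsum_congr fun k => ?_
      ring
  · refine Summable.of_nonneg_of_le (fun k => by positivity) (fun k => ?_)
      ((summable_fanDim_mul_pow hn (norm_nonneg r) hr).mul_right (∫ w, ‖g w‖))
    rw [← integral_const_mul]
    refine integral_mono_of_nonneg (Filter.Eventually.of_forall fun _ => norm_nonneg _)
      (hg.norm.const_mul _) (Filter.Eventually.of_forall fun w => ?_)
    simp only [norm_mul _ (g w * _), norm_mul (g w), norm_pow]
    have := mul_le_mul_of_nonneg_left (norm_twist_laguerrePhi_le hn k lam z w)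
      (mul_nonneg (pow_nonneg (norm_nonneg r) k) (norm_nonneg (g w)))
    linarith

attribute [irreducible] twistLaguerre

/-- For fixed `z` the numbers `ρ ^ k * twistLaguerre n k lam g z` are Fourier coefficients, in `t`,
of the twisted convolution with the generating function at `r = ρ e^{it}` (time `t` in units of the
full circle). Bessel's inequality in `t`, Tonelli and the bound uniform in `r` give the claim. -/
theorem tsum_pow_mul_lintegral_twistLaguerre_le {n : ℕ} (hn : 1 ≤ n) {lam : ℝ} (hlam : lam ≠ 0)
    {g : (Fin n → ℂ) → ℂ} (hgm : Measurable g) (hg : Integrable g) {ρ : ℝ} (h0 : 0 ≤ ρ)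
    (h1 : ρ < 1) :
    ∑' k, ENNReal.ofReal ρ ^ (2 * k) * ∫⁻ z, ‖twistLaguerre n k lam g z‖ₑ ^ 2
      ≤ ENNReal.ofReal ((8 * Real.pi ^ 2 / lam ^ 2) ^ n) * ∫⁻ w, ‖g w‖ₑ ^ 2 := by
  let R : UnitAddCircle → ℂ := fun t => ρ * fourier 1 t
  have hR : ∀ t, ‖R t‖ < 1 := by
    intro t
    have : ‖(fourier 1 t : ℂ)‖ = 1 := by
      rw [fourier_apply]
      exact Circle.norm_coe _
    simp only [R, norm_mul, this, Complex.norm_real, Real.norm_of_nonneg h0, mul_one]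
    exact h1
  have hRm : Measurable R := by
    have : Continuous R := by fun_prop
    exact this.measurable
  let h : UnitAddCircle → (Fin n → ℂ) → ℂ := fun t z =>
    ∫ w, g w * (twistPhase lam z w * laguerreGen n lam (R t) (z - w))
  have hhm : Measurable (Function.uncurry h) := by
    have h2 : Measurable fun q : (UnitAddCircle × (Fin n → ℂ)) × (Fin n → ℂ) =>
        (R q.1.1, q.1.2, q.2) :=
      (hRm.comp (measurable_fst.comp measurable_fst)).prodMk
        ((measurable_snd.comp measurable_fst).prodMk measurable_snd)
    have h3 : StronglyMeasurable fun q : (UnitAddCircle × (Fin n → ℂ)) × (Fin n → ℂ) =>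
        g q.2 * (twistPhase lam q.1.2 q.2 * laguerreGen n lam (R q.1.1) (q.1.2 - q.2)) :=
      ((hgm.comp measurable_snd).mul
        ((measurable_twist_laguerreGen n lam).comp h2)).stronglyMeasurable
    exact h3.integral_prod_right.measurable
  have hpt : ∀ z, ∑' k, ENNReal.ofReal ρ ^ (2 * k) * ‖twistLaguerre n k lam g z‖ₑ ^ 2
      ≤ ∫⁻ t, ‖h t z‖ₑ ^ 2 ∂AddCircle.haarAddCircle := by
    intro z
    have hs : Summable fun k => ‖(ρ : ℂ) ^ k * twistLaguerre n k lam g z‖ := by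
      refine Summable.of_nonneg_of_le (fun _ => norm_nonneg _) (fun k => ?_)
        ((summable_fanDim_mul_pow hn h0 h1).mul_right (∫ w, ‖g w‖))
      rw [norm_mul, norm_pow, Complex.norm_real, Real.norm_of_nonneg h0]
      have := mul_le_mul_of_nonneg_left (norm_twistLaguerre_le hn k lam hg z) (pow_nonneg h0 k)
      linarith
    refine le_of_eq_of_le ?_ ((tsum_enorm_sq_le_lintegral_fourier hs).trans_eq ?_)
    · refine tsum_congr fun k => ?_
      rw [enorm_mul, enorm_pow, mul_pow, ← pow_mul, mul_comm 2 k]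
      congr 2
      rw [← ofReal_norm, Complex.norm_real, Real.norm_of_nonneg h0]
    · refine lintegral_congr fun t => ?_
      congr 2
      refine Eq.trans ?_ (hasSum_pow_mul_twistLaguerre hn lam hg z (hR t)).tsum_eq
      refine tsum_congr fun k => ?_
      have : (fourier (k : ℤ) t : ℂ) = fourier 1 t ^ k := by
        rw [fourier_apply, fourier_apply, one_smul, natCast_zsmul, AddCircle.toCircle_nsmul]
        simp
      simp only [R, this, mul_pow]
      ring
  have hbound : ∀ t, ∫⁻ z, ‖h t z‖ₑ ^ 2
      ≤ ENNReal.ofReal ((8 * Real.pi ^ 2 / lam ^ 2) ^ n) * ∫⁻ w, ‖g w‖ₑ ^ 2 :=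
    fun t => lintegral_enorm_sq_twist_laguerreGen_le hlam (hR t) hgm hg
  have hmk : ∀ k, Measurable fun z => ENNReal.ofReal ρ ^ (2 * k)
      * ‖twistLaguerre n k lam g z‖ₑ ^ 2 :=
    fun k => ((measurable_twistLaguerre n k lam hgm).enorm.pow_const 2).const_mul _
  clear_value h
  calc ∑' k, ENNReal.ofReal ρ ^ (2 * k) * ∫⁻ z, ‖twistLaguerre n k lam g z‖ₑ ^ 2
      = ∫⁻ z, ∑' k, ENNReal.ofReal ρ ^ (2 * k) * ‖twistLaguerre n k lam g z‖ₑ ^ 2 := by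
        rw [lintegral_tsum fun k => (hmk k).aemeasurable]
        refine tsum_congr fun k => ?_
        rw [lintegral_const_mul' _ _ (by finiteness)]
    _ ≤ ∫⁻ z, (∫⁻ t, ‖h t z‖ₑ ^ 2 ∂AddCircle.haarAddCircle) ∂volume := lintegral_mono hpt
    _ = ∫⁻ t, (∫⁻ z, ‖h t z‖ₑ ^ 2 ∂volume) ∂AddCircle.haarAddCircle :=
        (lintegral_lintegral_swap (hhm.enorm.pow_const 2).aemeasurable).symm
    _ ≤ ∫⁻ _ : UnitAddCircle, (ENNReal.ofReal ((8 * Real.pi ^ 2 / lam ^ 2) ^ n)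
          * ∫⁻ w, ‖g w‖ₑ ^ 2) ∂AddCircle.haarAddCircle :=
        lintegral_mono hbound
    _ = _ := by simp

/-- A Bessel inequality for the special Hermite expansion. -/
theorem tsum_lintegral_twistLaguerre_le {n : ℕ} (hn : 1 ≤ n) {lam : ℝ} (hlam : lam ≠ 0)
    {g : (Fin n → ℂ) → ℂ} (hgm : Measurable g) (hg : Integrable g) :
    ∑' k, ∫⁻ z, ‖twistLaguerre n k lam g z‖ₑ ^ 2
      ≤ ENNReal.ofReal ((8 * Real.pi ^ 2 / lam ^ 2) ^ n) * ∫⁻ w, ‖g w‖ₑ ^ 2 := by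
  rw [ENNReal.tsum_eq_iSup_sum]
  refine iSup_le fun s => ?_
  -- Only finite sums are involved, so `ρ → 1` can be taken term by term, even if a term were
  -- infinite.
  have ht : Filter.Tendsto (fun ρ : ℝ => ∑ k ∈ s, ENNReal.ofReal ρ ^ (2 * k)
      * ∫⁻ z, ‖twistLaguerre n k lam g z‖ₑ ^ 2) (nhdsWithin 1 (Set.Iio 1))
      (nhds (∑ k ∈ s, ∫⁻ z, ‖twistLaguerre n k lam g z‖ₑ ^ 2)) := by
    refine tendsto_finsetSum _ fun k _ => ?_
    have h1 : Filter.Tendsto (fun ρ : ℝ => ENNReal.ofReal ρ ^ (2 * k)) (nhdsWithin 1 (Set.Iio 1))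
        (nhds 1) := by
      have : Filter.Tendsto (fun ρ : ℝ => ENNReal.ofReal ρ ^ (2 * k)) (nhds 1)
          (nhds (ENNReal.ofReal 1 ^ (2 * k))) :=
        ((ENNReal.continuous_pow (2 * k)).comp ENNReal.continuous_ofReal).tendsto 1
      rw [ENNReal.ofReal_one, one_pow] at this
      exact this.mono_left nhdsWithin_le_nhds
    simpa using ENNReal.Tendsto.mul_const h1 (Or.inl one_ne_zero)
  refine le_of_tendsto ht ?_
  have h01 : ∀ᶠ ρ : ℝ in nhdsWithin 1 (Set.Iio 1), 0 ≤ ρ ∧ ρ < 1 := by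
    filter_upwards [Ioo_mem_nhdsLT (zero_lt_one (α := ℝ))] with ρ hρ using ⟨hρ.1.le, hρ.2⟩
  filter_upwards [h01] with ρ hρ
  exact (ENNReal.sum_le_tsum s).trans
    (tsum_pow_mul_lintegral_twistLaguerre_le hn hlam hgm hg hρ.1 hρ.2)

/-! ### The Plancherel inequality on the line. -/

theorem lintegral_exp_neg_mul_sq {b : ℝ} (hb : 0 < b) :
    ∫⁻ t : ℝ, ENNReal.ofReal (Real.exp (-b * t ^ 2)) = ENNReal.ofReal (Real.sqrt (Real.pi / b)) := by
  rw [← ofReal_integral_eq_lintegral_ofReal (integrable_exp_neg_mul_sq hb)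
    (Filter.Eventually.of_forall fun _ => (Real.exp_pos _).le), integral_gaussian]

theorem norm_integral_gaussian_fourier {ε : ℝ} (hε : 0 < ε) (x : ℝ) :
    ‖∫ t : ℝ, ((Real.exp (-ε * t ^ 2) : ℝ) : ℂ) * Complex.exp (((t * x : ℝ) : ℂ) * Complex.I)‖
      = Real.sqrt (Real.pi / ε) * Real.exp (-(1 / (4 * ε)) * x ^ 2) := by
  have h := GaussianFourier.integral_cexp_neg_mul_sq_norm_add (V := ℝ) (b := (ε : ℂ))
    (by simpa using hε) Complex.I x
  have h2 : ∀ t : ℝ, Complex.exp (-(ε : ℂ) * ‖t‖ ^ 2 + Complex.I * (inner ℝ x t : ℝ))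
      = ((Real.exp (-ε * t ^ 2) : ℝ) : ℂ) * Complex.exp (((t * x : ℝ) : ℂ) * Complex.I) := by
    intro t
    have h3 : ((‖t‖ : ℝ) : ℂ) ^ 2 = ((t ^ 2 : ℝ) : ℂ) := by
      rw [← Complex.ofReal_pow, Real.norm_eq_abs, sq_abs]
    rw [Complex.ofReal_exp, ← Complex.exp_add, h3]
    congr 1
    simp
    ring
  simp only [h2] at h
  rw [h, norm_mul, Complex.norm_exp]
  congr 1
  · rw [Module.finrank_self, ← Complex.ofReal_div, Complex.norm_cpow_eq_rpow_re_of_pos (by positivity),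
      Real.sqrt_eq_rpow]
    norm_num
  · congr 1
    rw [Complex.I_sq, ← Complex.ofReal_pow, Real.norm_eq_abs, sq_abs]
    rw [show (-1 : ℂ) * ((x ^ 2 : ℝ) : ℂ) / (4 * (ε : ℂ))
      = ((-(1 / (4 * ε)) * x ^ 2 : ℝ) : ℂ) by push_cast; ring, Complex.ofReal_re]

/-- The Plancherel inequality on `ℝ`, damped by a Gaussian. -/
theorem lintegral_gaussian_mul_fourier_sq_le {f : ℝ → ℂ} (hfm : Measurable f) (hf : Integrable f)
    {ε : ℝ} (hε : 0 < ε) :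
    ∫⁻ t : ℝ, ENNReal.ofReal (Real.exp (-ε * t ^ 2))
        * ‖∫ s, f s * Complex.exp (((-(t * s) : ℝ) : ℂ) * Complex.I)‖ₑ ^ 2
      ≤ ENNReal.ofReal (2 * Real.pi) * ∫⁻ s, ‖f s‖ₑ ^ 2 := by
  -- The damping exponent is halved since the kernel enters squared.
  let k : ℝ → ℝ → ℂ := fun t s =>
    ((Real.exp (-(ε / 2) * t ^ 2) : ℝ) : ℂ) * Complex.exp (((-(t * s) : ℝ) : ℂ) * Complex.I)
  have hkm : Measurable (Function.uncurry k) := by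
    have : Continuous (Function.uncurry k) := by
      simp only [k, Function.uncurry_def]
      fun_prop
    exact this.measurable
  have hexp : ∀ t : ℝ, Real.exp (-(ε / 2) * t ^ 2) * Real.exp (-(ε / 2) * t ^ 2)
      = Real.exp (-ε * t ^ 2) := by
    intro t
    rw [← Real.exp_add]
    congr 1
    ring
  have hkn : ∀ t s, ‖k t s‖ₑ = ENNReal.ofReal (Real.exp (-(ε / 2) * t ^ 2)) := by
    intro t s
    rw [← ofReal_norm, norm_mul, Complex.norm_exp_ofReal_mul_I, mul_one, Complex.norm_real,
      Real.norm_of_nonneg (Real.exp_pos _).le]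
  have h := lintegral_enorm_sq_integral_mul_kernel_le (μ := (volume : Measure ℝ)) hkm
    (M := ENNReal.ofReal (Real.sqrt (Real.pi / ε))) (by finiteness) ?_
    (H := fun s s' => ENNReal.ofReal (Real.sqrt (Real.pi / ε))
      * ENNReal.ofReal (Real.exp (-(1 / (4 * ε)) * (s' - s) ^ 2))) (C := ENNReal.ofReal (2 * Real.pi))
    ?_ ?_ ?_ ?_ hfm hf
  · refine le_of_eq_of_le (lintegral_congr fun t => ?_) h
    have h1 : ∀ s, f s * k t s = ((Real.exp (-(ε / 2) * t ^ 2) : ℝ) : ℂ)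
        * (f s * Complex.exp (((-(t * s) : ℝ) : ℂ) * Complex.I)) := by
      intro s
      simp only [k]
      ring
    simp only [h1]
    rw [integral_const_mul, enorm_mul, mul_pow, ← hexp, ENNReal.ofReal_mul (Real.exp_pos _).le,
      ← ofReal_norm (((Real.exp (-(ε / 2) * t ^ 2) : ℝ) : ℂ)), Complex.norm_real,
      Real.norm_of_nonneg (Real.exp_pos _).le, sq (ENNReal.ofReal (Real.exp (-(ε / 2) * t ^ 2)))]
  · intro s s'
    simp only [hkn, ← ENNReal.ofReal_mul (Real.exp_pos _).le, hexp]
    exact (lintegral_exp_neg_mul_sq hε).le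
  · have : Measurable fun q : ℝ × ℝ => ENNReal.ofReal (Real.sqrt (Real.pi / ε))
        * ENNReal.ofReal (Real.exp (-(1 / (4 * ε)) * (q.2 - q.1) ^ 2)) := by fun_prop
    exact this
  · intro s s'
    rw [← neg_sub s s', neg_sq]
  · intro s
    rw [lintegral_const_mul' _ _ (by finiteness), lintegral_sub_right_eq_self
      (fun t : ℝ => ENNReal.ofReal (Real.exp (-(1 / (4 * ε)) * t ^ 2))) s,
      lintegral_exp_neg_mul_sq (by positivity), ← ENNReal.ofReal_mul (Real.sqrt_nonneg _),
      ← Real.sqrt_mul (by positivity)]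
    refine ENNReal.ofReal_le_ofReal (le_of_eq ?_)
    -- The composed kernel is an approximate identity of mass `2π` whatever `ε` is, which lets the
    -- damping be removed by Fatou's lemma.
    rw [show Real.pi / ε * (Real.pi / (1 / (4 * ε))) = (2 * Real.pi) ^ 2 by field_simp; ring,
      Real.sqrt_sq (by positivity)]
  · intro s s'
    have h1 : ∀ t, k t s * (starRingEnd ℂ) (k t s') = ((Real.exp (-ε * t ^ 2) : ℝ) : ℂ)
        * Complex.exp (((t * (s' - s) : ℝ) : ℂ) * Complex.I) := by
      intro t
      simp only [k, map_mul, Complex.conj_ofReal, ← Complex.exp_conj, Complex.conj_I]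
      rw [← hexp, mul_mul_mul_comm, ← Complex.exp_add, ← Complex.ofReal_mul]
      congr 2
      push_cast
      ring
    simp only [h1]
    rw [← ofReal_norm, norm_integral_gaussian_fourier hε, ENNReal.ofReal_mul (Real.sqrt_nonneg _)]

/-- The Plancherel inequality on `ℝ` for integrable functions. -/
theorem lintegral_fourier_sq_le {f : ℝ → ℂ} (hfm : Measurable f) (hf : Integrable f) :
    ∫⁻ t : ℝ, ‖∫ s, f s * Complex.exp (((-(t * s) : ℝ) : ℂ) * Complex.I)‖ₑ ^ 2
      ≤ ENNReal.ofReal (2 * Real.pi) * ∫⁻ s, ‖f s‖ₑ ^ 2 := by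
  let F : ℝ → ℂ := fun t => ∫ s, f s * Complex.exp (((-(t * s) : ℝ) : ℂ) * Complex.I)
  have hFm : Measurable F := by
    have h1 : Measurable fun q : ℝ × ℝ => Complex.exp (((-(q.1 * q.2) : ℝ) : ℂ) * Complex.I) := by
      fun_prop
    have h2 : StronglyMeasurable fun q : ℝ × ℝ =>
        f q.2 * Complex.exp (((-(q.1 * q.2) : ℝ) : ℂ) * Complex.I) :=
      ((hfm.comp measurable_snd).mul h1).stronglyMeasurable
    exact h2.integral_prod_right.measurable
  let w : ℕ → ℝ → ℝ≥0∞ := fun m t =>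
    ENNReal.ofReal (Real.exp (-(1 / ((m : ℝ) + 1)) * t ^ 2)) * ‖F t‖ₑ ^ 2
  have hw : ∀ m, Measurable (w m) := fun m =>
    Measurable.mul (by fun_prop) (hFm.enorm.pow_const 2)
  have hlim : ∀ t, Filter.Tendsto (fun m => w m t) Filter.atTop (nhds (‖F t‖ₑ ^ 2)) := by
    intro t
    have h1 : Filter.Tendsto (fun m : ℕ => ENNReal.ofReal (Real.exp (-(1 / ((m : ℝ) + 1)) * t ^ 2)))
        Filter.atTop (nhds 1) := by
      have h2 : Filter.Tendsto (fun m : ℕ => Real.exp (-(1 / ((m : ℝ) + 1)) * t ^ 2))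
          Filter.atTop (nhds (Real.exp (-0 * t ^ 2))) :=
        (Real.continuous_exp.tendsto _).comp
          ((tendsto_one_div_add_atTop_nhds_zero_nat (𝕜 := ℝ)).neg.mul_const _)
      have h3 := ENNReal.tendsto_ofReal h2
      simpa using h3
    have h4 := ENNReal.Tendsto.mul_const (b := ‖F t‖ₑ ^ 2) h1 (Or.inl one_ne_zero)
    rwa [one_mul] at h4
  calc ∫⁻ t : ℝ, ‖F t‖ₑ ^ 2 = ∫⁻ t, Filter.liminf (fun m => w m t) Filter.atTop :=
        lintegral_congr fun t => (hlim t).liminf_eq.symm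
    _ ≤ Filter.liminf (fun m => ∫⁻ t, w m t) Filter.atTop := lintegral_liminf_le hw
    _ ≤ Filter.liminf (fun _ : ℕ => ENNReal.ofReal (2 * Real.pi) * ∫⁻ s, ‖f s‖ₑ ^ 2)
          Filter.atTop := by
        refine Filter.liminf_le_liminf (Filter.Eventually.of_forall fun m => ?_)
        exact lintegral_gaussian_mul_fourier_sq_le hfm hf (by positivity)
    _ = _ := Filter.liminf_const _

/-! ### The transform as an integral operator with a measurable kernel bounded by `1`. -/

/-- A measurable version of `fanIndex`. -/
def fanFloor (n : ℕ) (a : ℝ × ℝ) : ℕ := ⌊(a.2 / |a.1| - n) / 2⌋₊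

theorem measurable_fanFloor (n : ℕ) : Measurable (fanFloor n) := by
  unfold fanFloor
  have : Measurable fun a : ℝ × ℝ => (a.2 / |a.1| - n) / 2 :=
    ((measurable_snd.div measurable_fst.abs).sub_const _).div_const _
  exact Nat.measurable_floor.comp this

theorem fanFloor_fanRay (n k : ℕ) {lam : ℝ} (h : lam ≠ 0) :
    fanFloor n (fanRay n k lam : ℝ × ℝ) = k := by
  have h' : |lam| ≠ 0 := abs_ne_zero.2 h
  have : ((2 * (k : ℝ) + n) * |lam| / |lam| - n) / 2 = k := by
    field_simp
    ring
  simp only [fanFloor, fanRay, this, Nat.floor_natCast]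

theorem exists_fanRay_eq {n : ℕ} {a : heisFan n} (ha : (a : ℝ × ℝ).1 ≠ 0) :
    ∃ k, a = fanRay n k (a : ℝ × ℝ).1 := by
  rcases a.2 with h | h
  · obtain ⟨k, hk⟩ := Set.mem_iUnion.1 h
    exact ⟨k, Subtype.ext (Prod.ext rfl hk)⟩
  · exact absurd h.1 ha

theorem fanFloor_eq_fanIndex {n : ℕ} {a : heisFan n} (ha : (a : ℝ × ℝ).1 ≠ 0) :
    fanFloor n (a : ℝ × ℝ) = fanIndex n (a : ℝ × ℝ) := by
  obtain ⟨k, hk⟩ := exists_fanRay_eq ha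
  rw [hk, fanFloor_fanRay n k ha, fanIndex_fanRay n k ha]

theorem fanDim_pos {n : ℕ} (k : ℕ) : 0 < fanDim n k := by
  unfold fanDim
  positivity

theorem continuous_laguerreE (n k : ℕ) :
    Continuous fun q : ℝ × Heis n => laguerreE n k q.1 q.2 := by
  have := continuous_cnorm (n := n)
  unfold laguerreE laguerrePhi laguerreL
  fun_prop

theorem continuous_ginv_gmul (n : ℕ) :
    Continuous fun q : (Fin n → ℂ) × Heis n => Heis.gmul (Heis.ginv q.2) (q.1, 0) := by
  unfold Heis.gmul Heis.ginv
  fun_prop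

/-- The integral kernel of `f ↦ f̃` off the limiting ray. -/
def fanKernel (n : ℕ) (x : heisFan n × (Fin n → ℂ)) (g : Heis n) : ℂ :=
  ((fanDim n (fanFloor n (x.1 : ℝ × ℝ)))⁻¹ : ℝ)
    * laguerreE n (fanFloor n (x.1 : ℝ × ℝ)) (x.1 : ℝ × ℝ).1 (Heis.gmul (Heis.ginv g) (x.2, 0))

theorem measurable_fanKernel (n : ℕ) : Measurable (Function.uncurry (fanKernel n)) := by
  have h1 : Measurable fun q : ℕ × (ℝ × Heis n) => laguerreE n q.1 q.2.1 q.2.2 :=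
    measurable_from_prod_countable_right fun k => (continuous_laguerreE n k).measurable
  have h2 : Measurable fun q : (heisFan n × (Fin n → ℂ)) × Heis n => (q.1.1 : ℝ × ℝ) :=
    measurable_subtype_coe.comp (measurable_fst.comp measurable_fst)
  have h3 : Measurable fun q : (heisFan n × (Fin n → ℂ)) × Heis n =>
      Heis.gmul (Heis.ginv q.2) (q.1.2, 0) :=
    (continuous_ginv_gmul n).measurable.comp
      ((measurable_snd.comp measurable_fst).prodMk measurable_snd)
  have h4 : Measurable fun q : (heisFan n × (Fin n → ℂ)) × Heis n =>
      fanFloor n (q.1.1 : ℝ × ℝ) := (measurable_fanFloor n).comp h2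
  have h5 : Measurable fun q : (heisFan n × (Fin n → ℂ)) × Heis n =>
      (((fanDim n (fanFloor n (q.1.1 : ℝ × ℝ)))⁻¹ : ℝ) : ℂ) :=
    Complex.measurable_ofReal.comp ((measurable_from_nat (f := fun k => (fanDim n k)⁻¹)).comp h4)
  have h6 : Measurable fun q : (heisFan n × (Fin n → ℂ)) × Heis n => (fanFloor n (q.1.1 : ℝ × ℝ),
      ((q.1.1 : ℝ × ℝ).1, Heis.gmul (Heis.ginv q.2) (q.1.2, 0))) :=
    h4.prodMk ((measurable_fst.comp h2).prodMk h3)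
  have h7 := h1.comp h6
  have h8 := h5.mul h7
  exact h8

theorem norm_fanKernel_le {n : ℕ} (hn : 1 ≤ n) (x : heisFan n × (Fin n → ℂ)) (g : Heis n) :
    ‖fanKernel n x g‖ ≤ 1 := by
  have h := fanDim_pos (n := n) (fanFloor n (x.1 : ℝ × ℝ))
  rw [fanKernel, norm_mul, Complex.norm_real, Real.norm_of_nonneg (inv_nonneg.2 h.le),
    inv_mul_le_one₀ h]
  exact norm_laguerreE_le hn _ _ _

theorem strichartzTilde_eq_integral_fanKernel {n : ℕ} (f : Heis n → ℂ)
    {x : heisFan n × (Fin n → ℂ)} (hx : (x.1 : ℝ × ℝ).1 ≠ 0) :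
    strichartzTilde n f x.1 x.2 = ∫ g, f g * fanKernel n x g := by
  simp only [strichartzTilde, strichartzHat, if_neg hx, fanKernel, fanFloor_eq_fanIndex hx]
  rw [← integral_const_mul]
  refine integral_congr_ae (Filter.Eventually.of_forall fun g => ?_)
  simp only
  ring

/-- Each parametrized ray meets the limiting ray only at parameter `0`. The Bessel function formula
therefore has no influence on the norms. -/
theorem fanMeasure_fst_eq_zero (n : ℕ) (W : ℕ → ℝ → ℝ) :
    fanMeasure n W {a : heisFan n | (a : ℝ × ℝ).1 = 0} = 0 := by
  have hm : MeasurableSet {a : heisFan n | (a : ℝ × ℝ).1 = 0} :=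
    (measurable_fst.comp measurable_subtype_coe) (measurableSet_singleton (0 : ℝ))
  rw [fanMeasure, Measure.sum_apply _ hm, ENNReal.tsum_eq_zero]
  intro k
  rw [Measure.map_apply (measurable_fanRay n k) hm]
  refine withDensity_absolutelyContinuous _ _ ?_
  have : fanRay n k ⁻¹' {a : heisFan n | (a : ℝ × ℝ).1 = 0} = {0} := by
    ext lam
    simp [fanRay]
  rw [this, Real.volume_singleton]

theorem ae_fanNu_prod_fst_ne_zero (n : ℕ) (p : ℝ≥0∞) :
    ∀ᵐ x : heisFan n × (Fin n → ℂ) ∂(fanNu n p).prod volume, (x.1 : ℝ × ℝ).1 ≠ 0 := by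
  have h : fanNu n p {a : heisFan n | (a : ℝ × ℝ).1 = 0} = 0 := by
    unfold fanNu
    split_ifs <;> exact fanMeasure_fst_eq_zero n _
  have h2 : ∀ᵐ a : heisFan n ∂fanNu n p, (a : ℝ × ℝ).1 ≠ 0 := by
    rw [ae_iff]
    simpa using h
  exact Measure.quasiMeasurePreserving_fst.ae h2

theorem strichartzTilde_ae_eq (n : ℕ) (p : ℝ≥0∞) (f : Heis n → ℂ) :
    (fun x : heisFan n × (Fin n → ℂ) => strichartzTilde n f x.1 x.2)
      =ᵐ[(fanNu n p).prod volume] fun x => ∫ g, f g * fanKernel n x g := by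
  filter_upwards [ae_fanNu_prod_fst_ne_zero n p] with x hx
  exact strichartzTilde_eq_integral_fanKernel f hx

/-! ### The `L²` bound for the transform. -/

/-- The partial Fourier transform in the central variable. -/
def centralFourier {n : ℕ} (f : Heis n → ℂ) (lam : ℝ) (w : Fin n → ℂ) : ℂ :=
  ∫ s, f (w, s) * Complex.exp (((-(lam * s) : ℝ) : ℂ) * Complex.I)

theorem measurable_centralFourier {n : ℕ} {f : Heis n → ℂ} (hfm : Measurable f) :
    Measurable fun q : ℝ × (Fin n → ℂ) => centralFourier f q.1 q.2 := by
  have h1 : Measurable fun q : (ℝ × (Fin n → ℂ)) × ℝ => (q.1.2, q.2) :=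
    (measurable_snd.comp measurable_fst).prodMk measurable_snd
  have h2 : Measurable fun q : (ℝ × (Fin n → ℂ)) × ℝ =>
      Complex.exp (((-(q.1.1 * q.2) : ℝ) : ℂ) * Complex.I) := by
    have : Continuous fun q : (ℝ × (Fin n → ℂ)) × ℝ =>
        Complex.exp (((-(q.1.1 * q.2) : ℝ) : ℂ) * Complex.I) := by fun_prop
    exact this.measurable
  have h3 : StronglyMeasurable fun q : (ℝ × (Fin n → ℂ)) × ℝ =>
      f (q.1.2, q.2) * Complex.exp (((-(q.1.1 * q.2) : ℝ) : ℂ) * Complex.I) :=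
    ((hfm.comp h1).mul h2).stronglyMeasurable
  exact h3.integral_prod_right.measurable

theorem integrable_mul_character {n : ℕ} {f : Heis n → ℂ} (hf : Integrable f) (lam : ℝ) :
    Integrable fun g : Heis n => f g * Complex.exp (((-(lam * g.2) : ℝ) : ℂ) * Complex.I) := by
  refine hf.mul_bdd (c := 1) ?_ (Filter.Eventually.of_forall fun g => ?_)
  · have : Continuous fun g : Heis n =>
        Complex.exp (((-(lam * g.2) : ℝ) : ℂ) * Complex.I) := by fun_prop
    exact this.aestronglyMeasurable
  · rw [Complex.norm_exp_ofReal_mul_I]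

theorem integrable_centralFourier {n : ℕ} {f : Heis n → ℂ} (hf : Integrable f) (lam : ℝ) :
    Integrable (centralFourier f lam) :=
  Integrable.integral_prod_left (μ := (volume : Measure (Fin n → ℂ))) (ν := (volume : Measure ℝ))
    (integrable_mul_character hf lam)

theorem lintegral_centralFourier_sq_le {n : ℕ} {f : Heis n → ℂ} (hfm : Measurable f)
    (hf : Integrable f) :
    ∫⁻ lam, (∫⁻ w, ‖centralFourier f lam w‖ₑ ^ 2)
      ≤ ENNReal.ofReal (2 * Real.pi) * ∫⁻ g, ‖f g‖ₑ ^ 2 := by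
  rw [lintegral_lintegral_swap ((measurable_centralFourier hfm).enorm.pow_const 2).aemeasurable,
    show (volume : Measure (Heis n)) = (volume : Measure (Fin n → ℂ)).prod (volume : Measure ℝ)
      from rfl, lintegral_prod _ (hfm.enorm.pow_const 2).aemeasurable,
    ← lintegral_const_mul' _ _ (by finiteness)]
  have hf' : Integrable f ((volume : Measure (Fin n → ℂ)).prod (volume : Measure ℝ)) := hf
  refine lintegral_mono_ae ?_
  filter_upwards [hf'.prod_right_ae] with w hw
  exact lintegral_fourier_sq_le (hfm.comp measurable_prodMk_left) hw

/-- The group law splits the kernel into a character of the central variable and a twisted translate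
of the Laguerre function; the symplectic term of the product is the phase. -/
theorem laguerreE_ginv_gmul {n : ℕ} (k : ℕ) (lam : ℝ) (w z : Fin n → ℂ) (s : ℝ) :
    laguerreE n k lam (Heis.gmul (Heis.ginv (w, s)) (z, 0))
      = Complex.exp (((-(lam * s) : ℝ) : ℂ) * Complex.I)
        * (twistPhase lam z w * (laguerrePhi n k lam (z - w) : ℂ)) := by
  rw [laguerreE, twistPhase, ← mul_assoc, ← Complex.exp_add, ← add_mul, ← Complex.ofReal_add,
    mul_comm Complex.I]
  simp only [Heis.gmul, Heis.ginv, Pi.neg_apply, neg_mul, Finset.sum_neg_distrib, Complex.neg_im]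
  rw [show -w + z = z - w by abel]
  congr 5
  ring

/-- Integrating out the central variable turns convolution on the group into twisted convolution on
`ℂⁿ`. -/
theorem integral_fanKernel_fanRay {n : ℕ} (hn : 1 ≤ n) (k : ℕ) {lam : ℝ} (hlam : lam ≠ 0)
    {f : Heis n → ℂ} (hf : Integrable f) (z : Fin n → ℂ) :
    ∫ g, f g * fanKernel n (fanRay n k lam, z) g
      = ((fanDim n k)⁻¹ : ℝ) * twistLaguerre n k lam (centralFourier f lam) z := by
  have h1 : ∀ g : Heis n, f g * fanKernel n (fanRay n k lam, z) g = ((fanDim n k)⁻¹ : ℝ)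
      * ((f g * Complex.exp (((-(lam * g.2) : ℝ) : ℂ) * Complex.I))
        * (twistPhase lam z g.1 * (laguerrePhi n k lam (z - g.1) : ℂ))) := by
    rintro ⟨w, s⟩
    rw [fanKernel, fanFloor_fanRay n k hlam, show ((fanRay n k lam : heisFan n) : ℝ × ℝ).1 = lam
      from rfl, laguerreE_ginv_gmul]
    ring
  simp only [h1]
  rw [integral_const_mul, twistLaguerre]
  congr 1
  have h2 : Integrable (fun g : Heis n => (f g * Complex.exp (((-(lam * g.2) : ℝ) : ℂ) * Complex.I))
      * (twistPhase lam z g.1 * (laguerrePhi n k lam (z - g.1) : ℂ)))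
      ((volume : Measure (Fin n → ℂ)).prod (volume : Measure ℝ)) := by
    refine (integrable_mul_character hf lam).mul_bdd (c := fanDim n k) ?_
      (Filter.Eventually.of_forall fun g => norm_twist_laguerrePhi_le hn k lam z g.1)
    have h3 : Measurable fun w => twistPhase lam z w * (laguerrePhi n k lam (z - w) : ℂ) :=
      (measurable_twist_laguerrePhi n k lam).comp measurable_prodMk_left
    exact (h3.comp measurable_fst).aestronglyMeasurable
  rw [show (volume : Measure (Heis n)) = (volume : Measure (Fin n → ℂ)).prod (volume : Measure ℝ)
      from rfl, integral_prod _ h2]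
  simp only [integral_mul_const, centralFourier]

/-- The `L²` bound for `f ↦ f̃` on integrable functions. -/
theorem lintegral_integral_fanKernel_sq_le {n : ℕ} (hn : 1 ≤ n) {f : Heis n → ℂ}
    (hfm : Measurable f) (hf : Integrable f) :
    ∫⁻ x, ‖∫ g, f g * fanKernel n x g‖ₑ ^ 2 ∂(fanMeasure n (fanWeightTwo n)).prod volume
      ≤ ENNReal.ofReal (2 ^ n) * ∫⁻ g, ‖f g‖ₑ ^ 2 := by
  let G : heisFan n × (Fin n → ℂ) → ℂ := fun x => ∫ g, f g * fanKernel n x g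
  have hGm : Measurable G := by
    have h : StronglyMeasurable fun q : (heisFan n × (Fin n → ℂ)) × Heis n =>
        f q.2 * Function.uncurry (fanKernel n) q :=
      ((hfm.comp measurable_snd).mul (measurable_fanKernel n)).stronglyMeasurable
    exact h.integral_prod_right.measurable
  have hG2 : Measurable fun x => ‖G x‖ₑ ^ 2 := hGm.enorm.pow_const 2
  have hW : ∀ k, Measurable (fanWeightTwo n k) := by
    intro k
    unfold fanWeightTwo
    fun_prop
  have hinner : Measurable fun a : heisFan n => ∫⁻ z, ‖G (a, z)‖ₑ ^ 2 :=
    hG2.lintegral_prod_right'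
  have hray : ∀ k, Measurable fun lam => ENNReal.ofReal (fanWeightTwo n k lam)
      * ∫⁻ z, ‖G (fanRay n k lam, z)‖ₑ ^ 2 :=
    fun k => (hW k).ennreal_ofReal.mul (hinner.comp (measurable_fanRay n k))
  have hslice : ∀ lam : ℝ, lam ≠ 0 → ∑' k, ENNReal.ofReal (fanWeightTwo n k lam)
        * ∫⁻ z, ‖G (fanRay n k lam, z)‖ₑ ^ 2
      ≤ ENNReal.ofReal (((2 * Real.pi) ^ (2 * n + 1))⁻¹ * (8 * Real.pi ^ 2) ^ n)
        * ∫⁻ w, ‖centralFourier f lam w‖ₑ ^ 2 := by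
    intro lam hlam
    have hl0 : 0 < |lam| := abs_pos.2 hlam
    -- The factor `d_k²` of the weight cancels the normalisation `d_k⁻²`, so the Bessel inequality
    -- applies to the sum over `k`; its `lam⁻²ⁿ` then cancels `|lam| ^ (2 * n)`.
    have h1 : ∀ k, ENNReal.ofReal (fanWeightTwo n k lam) * ∫⁻ z, ‖G (fanRay n k lam, z)‖ₑ ^ 2
        = ENNReal.ofReal (((2 * Real.pi) ^ (2 * n + 1))⁻¹ * |lam| ^ (2 * n))
          * ∫⁻ z, ‖twistLaguerre n k lam (centralFourier f lam) z‖ₑ ^ 2 := by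
      intro k
      have hd := fanDim_pos (n := n) k
      have h2 : ∀ z, ‖G (fanRay n k lam, z)‖ₑ ^ 2 = ENNReal.ofReal ((fanDim n k)⁻¹ ^ 2)
          * ‖twistLaguerre n k lam (centralFourier f lam) z‖ₑ ^ 2 := by
        intro z
        simp only [G]
        rw [integral_fanKernel_fanRay hn k hlam hf, enorm_mul, mul_pow,
          ENNReal.ofReal_pow (by positivity), ← ofReal_norm (((fanDim n k)⁻¹ : ℝ) : ℂ),
          Complex.norm_real, Real.norm_of_nonneg (by positivity)]
      simp only [h2]
      rw [lintegral_const_mul' _ _ (by finiteness), ← mul_assoc, ← ENNReal.ofReal_mul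
        (by unfold fanWeightTwo; positivity), fanWeightTwo]
      congr 2
      field_simp
    simp only [h1]
    rw [ENNReal.tsum_mul_left]
    refine (mul_le_mul_right (tsum_lintegral_twistLaguerre_le hn hlam
      ((measurable_centralFourier hfm).comp measurable_prodMk_left)
      (integrable_centralFourier hf lam)) _).trans_eq ?_
    rw [← mul_assoc, ← ENNReal.ofReal_mul (by positivity)]
    congr 2
    rw [mul_assoc, pow_mul, sq_abs, ← mul_pow]
    congr 2
    field_simp
  rw [lintegral_prod _ hG2.aemeasurable, lintegral_fanMeasure n _ hW hinner,
    ← lintegral_tsum fun k => (hray k).aemeasurable]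
  calc ∫⁻ lam, ∑' k, ENNReal.ofReal (fanWeightTwo n k lam) * ∫⁻ z, ‖G (fanRay n k lam, z)‖ₑ ^ 2
      ≤ ∫⁻ lam, ENNReal.ofReal (((2 * Real.pi) ^ (2 * n + 1))⁻¹ * (8 * Real.pi ^ 2) ^ n)
          * ∫⁻ w, ‖centralFourier f lam w‖ₑ ^ 2 := by
        refine lintegral_mono_ae ?_
        have h0 : ∀ᵐ lam : ℝ, lam ≠ 0 := by
          rw [ae_iff]
          simp
        filter_upwards [h0] with lam hlam using hslice lam hlam
    _ ≤ ENNReal.ofReal (((2 * Real.pi) ^ (2 * n + 1))⁻¹ * (8 * Real.pi ^ 2) ^ n)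
          * (ENNReal.ofReal (2 * Real.pi) * ∫⁻ g, ‖f g‖ₑ ^ 2) := by
        rw [lintegral_const_mul' _ _ (by finiteness)]
        gcongr
        exact lintegral_centralFourier_sq_le hfm hf
    _ = ENNReal.ofReal (2 ^ n) * ∫⁻ g, ‖f g‖ₑ ^ 2 := by
        rw [← mul_assoc, ← ENNReal.ofReal_mul (by positivity)]
        congr 2
        -- All powers of `2π` cancel; the surviving `2 ^ n` is the loss in the Schur estimate.
        rw [pow_succ, pow_mul, show (8 * Real.pi ^ 2 : ℝ) = 2 * (2 * Real.pi) ^ 2 by ring,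
          mul_pow 2 ((2 * Real.pi) ^ 2)]
        have ha : (((2 * Real.pi) ^ 2) ^ n : ℝ) ≠ 0 := by positivity
        have hb : (2 * Real.pi : ℝ) ≠ 0 := by positivity
        generalize ((2 * Real.pi) ^ 2) ^ n = a at *
        generalize 2 * Real.pi = b at *
        field_simp

/-! ### Marcinkiewicz interpolation. -/

theorem lintegral_Ioc_rpow {b r : ℝ} (hb : 0 ≤ b) (hr : -1 < r) :
    ∫⁻ t in Set.Ioc 0 b, ENNReal.ofReal (t ^ r) = ENNReal.ofReal (b ^ (r + 1) / (r + 1)) := by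
  have hi : IntervalIntegrable (fun t : ℝ => t ^ r) volume 0 b :=
    intervalIntegral.intervalIntegrable_rpow' hr
  rw [← ofReal_integral_eq_lintegral_ofReal ((intervalIntegrable_iff_integrableOn_Ioc_of_le hb).1 hi)
    ((ae_restrict_mem measurableSet_Ioc).mono fun t ht => Real.rpow_nonneg ht.1.le _),
    ← intervalIntegral.integral_of_le hb, integral_rpow (Or.inl hr), Real.zero_rpow (by linarith),
    sub_zero]

/-- The distributional estimate of the Marcinkiewicz interpolation: splitting `f` according to its
size, the large part is controlled by the bound `L¹ → L^∞` and the small one by `L² → L²`. -/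
theorem measure_lt_norm_integral_mul_kernel_le {X Y : Type*} [MeasurableSpace X] [MeasurableSpace Y]
    {μ : Measure X} {ν : Measure Y} [SFinite ν] {K : X → Y → ℂ}
    (hK : Measurable (Function.uncurry K)) (hK1 : ∀ x y, ‖K x y‖ ≤ 1) {B : ℝ}
    (hL2 : ∀ f : Y → ℂ, Measurable f → Integrable f ν →
      ∫⁻ x, ‖∫ y, f y * K x y ∂ν‖ₑ ^ 2 ∂μ ≤ ENNReal.ofReal B * ∫⁻ y, ‖f y‖ₑ ^ 2 ∂ν)
    {p : ℝ} (hp : 1 < p) {f : Y → ℂ} (hfm : Measurable f) (hf : Integrable f ν) {N : ℝ} (hN : 0 < N)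
    (hfN : ∫⁻ y, ENNReal.ofReal (‖f y‖ ^ p) ∂ν ≤ ENNReal.ofReal N) {α : ℝ} (hα : 0 < α) :
    μ {x | α < ‖∫ y, f y * K x y ∂ν‖} ≤ ENNReal.ofReal (4 * B * (α ^ 2)⁻¹)
      * ∫⁻ y, {y | α * ‖f y‖ ^ (p - 1) ≤ 2 * N}.indicator (fun y => ‖f y‖ₑ ^ 2) y ∂ν := by
  -- Off `S` one has `‖f‖ ≤ α / (2 N) * ‖f‖ ^ p`, so that part of `f` has `L¹` norm at most `α / 2`
  -- and its image never exceeds `α / 2`. The image of the part on `S` must then exceed `α / 2`, and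
  -- Chebyshev with the `L²` bound applies.
  set S : Set Y := {y | α * ‖f y‖ ^ (p - 1) ≤ 2 * N} with hS
  have hSm : MeasurableSet S :=
    measurableSet_le ((hfm.norm.pow_const _).const_mul _) measurable_const
  have hKx : ∀ x, Measurable (K x) := fun x => hK.comp measurable_prodMk_left
  have hint : ∀ g : Y → ℂ, Integrable g ν → ∀ x, Integrable (fun y => g y * K x y) ν :=
    fun g hg x => hg.mul_bdd (hKx x).aestronglyMeasurable (Filter.Eventually.of_forall (hK1 x))
  have hT : ∀ x, ∫ y, f y * K x y ∂ν
      = ∫ y, Sᶜ.indicator f y * K x y ∂ν + ∫ y, S.indicator f y * K x y ∂ν := by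
    intro x
    rw [← integral_add (hint _ (hf.indicator hSm.compl) x) (hint _ (hf.indicator hSm) x)]
    refine integral_congr_ae (Filter.Eventually.of_forall fun y => ?_)
    simp only
    rw [← add_mul, Set.indicator_compl_add_self_apply]
  have hT1 : ∀ x, ‖∫ y, Sᶜ.indicator f y * K x y ∂ν‖ ≤ α / 2 := by
    intro x
    have h1 : ‖∫ y, Sᶜ.indicator f y * K x y ∂ν‖ₑ ≤ ENNReal.ofReal (α / 2) := by
      calc ‖∫ y, Sᶜ.indicator f y * K x y ∂ν‖ₑ ≤ ∫⁻ y, ‖Sᶜ.indicator f y * K x y‖ₑ ∂ν :=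
            enorm_integral_le_lintegral_enorm _
        _ ≤ ∫⁻ y, ENNReal.ofReal (α / (2 * N)) * ENNReal.ofReal (‖f y‖ ^ p) ∂ν := by
            refine lintegral_mono fun y => ?_
            rw [← ENNReal.ofReal_mul (by positivity), ← ofReal_norm]
            refine ENNReal.ofReal_le_ofReal ?_
            rw [norm_mul]
            by_cases hy : y ∈ S
            · rw [Set.indicator_of_notMem (by simpa using hy)]
              simp only [norm_zero, zero_mul]
              positivity
            · rw [Set.indicator_of_mem (by simpa using hy)]
              have hy' : 2 * N < α * ‖f y‖ ^ (p - 1) := by simpa [hS] using hy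
              have hp0 : ‖f y‖ ^ p = ‖f y‖ ^ (p - 1) * ‖f y‖ := by
                rcases (norm_nonneg (f y)).eq_or_lt with h0 | h0
                · rw [← h0, Real.zero_rpow (by linarith), mul_zero]
                · rw [Real.rpow_sub_one h0.ne']
                  field_simp
              rw [hp0]
              have h2 : 1 ≤ α / (2 * N) * ‖f y‖ ^ (p - 1) := by
                rw [div_mul_eq_mul_div, le_div_iff₀ (by positivity)]
                linarith
              calc ‖f y‖ * ‖K x y‖ ≤ ‖f y‖ * 1 := by gcongr; exact hK1 x y
                _ = 1 * ‖f y‖ := by ring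
                _ ≤ (α / (2 * N) * ‖f y‖ ^ (p - 1)) * ‖f y‖ := by gcongr
                _ = _ := by ring
        _ ≤ ENNReal.ofReal (α / (2 * N)) * ENNReal.ofReal N := by
            rw [lintegral_const_mul' _ _ (by finiteness)]
            gcongr
        _ = ENNReal.ofReal (α / 2) := by
            rw [← ENNReal.ofReal_mul (by positivity)]
            congr 1
            field_simp
    rw [← ofReal_norm] at h1
    exact (ENNReal.ofReal_le_ofReal_iff (by positivity)).1 h1
  have hsub : {x | α < ‖∫ y, f y * K x y ∂ν‖}
      ⊆ {x | ENNReal.ofReal ((α / 2) ^ 2) ≤ ‖∫ y, S.indicator f y * K x y ∂ν‖ₑ ^ 2} := by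
    intro x hx
    simp only [Set.mem_ofPred_eq] at hx ⊢
    rw [hT] at hx
    have h1 := norm_add_le (∫ y, Sᶜ.indicator f y * K x y ∂ν) (∫ y, S.indicator f y * K x y ∂ν)
    have h2 := hT1 x
    rw [← ofReal_norm, ← ENNReal.ofReal_pow (norm_nonneg _)]
    refine ENNReal.ofReal_le_ofReal (pow_le_pow_left₀ (by positivity) ?_ 2)
    linarith
  have hTm : Measurable fun x => ∫ y, S.indicator f y * K x y ∂ν := by
    have h : StronglyMeasurable fun q : X × Y => S.indicator f q.2 * Function.uncurry K q :=
      (((hfm.indicator hSm).comp measurable_snd).mul hK).stronglyMeasurable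
    exact h.integral_prod_right.measurable
  have hcheb := mul_meas_ge_le_lintegral (μ := μ) (hTm.enorm.pow_const 2)
    (ENNReal.ofReal ((α / 2) ^ 2))
  have h2 := (hcheb.trans (hL2 _ (hfm.indicator hSm) (hf.indicator hSm)))
  have h3 : ∀ y, ‖S.indicator f y‖ₑ ^ 2 = S.indicator (fun y => ‖f y‖ₑ ^ 2) y := by
    intro y
    by_cases hy : y ∈ S <;> simp [hy]
  simp only [h3] at h2
  calc μ {x | α < ‖∫ y, f y * K x y ∂ν‖}
      ≤ μ {x | ENNReal.ofReal ((α / 2) ^ 2) ≤ ‖∫ y, S.indicator f y * K x y ∂ν‖ₑ ^ 2} :=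
        measure_mono hsub
    _ = ENNReal.ofReal (4 * (α ^ 2)⁻¹) * (ENNReal.ofReal ((α / 2) ^ 2)
          * μ {x | ENNReal.ofReal ((α / 2) ^ 2) ≤ ‖∫ y, S.indicator f y * K x y ∂ν‖ₑ ^ 2}) := by
        rw [← mul_assoc, ← ENNReal.ofReal_mul (by positivity),
          show 4 * (α ^ 2)⁻¹ * (α / 2) ^ 2 = 1 by field_simp; norm_num, ENNReal.ofReal_one, one_mul]
    _ ≤ ENNReal.ofReal (4 * (α ^ 2)⁻¹) * (ENNReal.ofReal B
          * ∫⁻ y, S.indicator (fun y => ‖f y‖ₑ ^ 2) y ∂ν) := by gcongr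
    _ = _ := by
        rw [← mul_assoc, ← ENNReal.ofReal_mul (by positivity)]
        congr 2
        ring

/-- Marcinkiewicz interpolation between `L¹ → L^∞` and `L² → L²` for an integral operator with
bounded kernel. -/
theorem lintegral_rpow_norm_integral_mul_kernel_le {X Y : Type*} [MeasurableSpace X]
    [MeasurableSpace Y] {μ : Measure X} {ν : Measure Y} [SFinite ν] {K : X → Y → ℂ}
    (hK : Measurable (Function.uncurry K)) (hK1 : ∀ x y, ‖K x y‖ ≤ 1) {B : ℝ} (hB : 0 ≤ B)
    (hL2 : ∀ f : Y → ℂ, Measurable f → Integrable f ν →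
      ∫⁻ x, ‖∫ y, f y * K x y ∂ν‖ₑ ^ 2 ∂μ ≤ ENNReal.ofReal B * ∫⁻ y, ‖f y‖ₑ ^ 2 ∂ν)
    {p q : ℝ} (hpq : p.HolderConjugate q) (hp2 : p < 2) {f : Y → ℂ} (hfm : Measurable f)
    (hf : Integrable f ν) {N : ℝ} (hN : 0 < N)
    (hfN : ∫⁻ y, ENNReal.ofReal (‖f y‖ ^ p) ∂ν ≤ ENNReal.ofReal N) :
    ∫⁻ x, ENNReal.ofReal (‖∫ y, f y * K x y ∂ν‖ ^ q) ∂μ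
      ≤ ENNReal.ofReal (q * (4 * B) * 2 ^ (q - 2) / (q - 2) * N ^ (q - 1)) := by
  have hp := hpq.lt
  have hq0 : 0 < q := hpq.symm.pos
  have hmul : (p - 1) * q = p := hpq.sub_one_mul_conj
  have hq2 : 2 < q := by nlinarith
  have hTm : Measurable fun x => ∫ y, f y * K x y ∂ν := by
    have h : StronglyMeasurable fun q : X × Y => f q.2 * Function.uncurry K q :=
      ((hfm.comp measurable_snd).mul hK).stronglyMeasurable
    exact h.integral_prod_right.measurable
  rw [lintegral_rpow_eq_lintegral_meas_lt_mul μ (Filter.Eventually.of_forall fun _ => norm_nonneg _)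
    hTm.norm.aemeasurable hq0]
  let D : Set (ℝ × Y) := {a | a.1 * ‖f a.2‖ ^ (p - 1) ≤ 2 * N}
  have hD : MeasurableSet D := measurableSet_le
    (measurable_fst.mul ((hfm.comp measurable_snd).norm.pow_const _)) measurable_const
  let Φ : ℝ → Y → ℝ≥0∞ := fun α y =>
    ENNReal.ofReal (4 * B) * ENNReal.ofReal (α ^ (q - 3))
      * D.indicator (fun a => ‖f a.2‖ₑ ^ 2) (α, y)
  have hΦ : Measurable (Function.uncurry Φ) := by
    have h1 : Measurable fun a : ℝ × Y => ENNReal.ofReal (4 * B) * ENNReal.ofReal (a.1 ^ (q - 3)) :=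
      ((measurable_fst.pow_const _).ennreal_ofReal).const_mul _
    have h2 : Measurable (D.indicator fun a : ℝ × Y => ‖f a.2‖ₑ ^ 2) :=
      ((hfm.comp measurable_snd).enorm.pow_const 2).indicator hD
    exact h1.mul h2
  have hdist : ∀ α ∈ Set.Ioi (0 : ℝ), μ {x | α < ‖∫ y, f y * K x y ∂ν‖}
      * ENNReal.ofReal (α ^ (q - 1)) ≤ ∫⁻ y, Φ α y ∂ν := by
    intro α hα
    have hα : 0 < α := hα
    refine (mul_le_mul_left (measure_lt_norm_integral_mul_kernel_le hK hK1 hL2 hp hfm hf hN hfN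
      hα) _).trans_eq ?_
    rw [mul_right_comm, ← ENNReal.ofReal_mul (by positivity), ← lintegral_const_mul' _ _
      (by finiteness)]
    refine lintegral_congr fun y => ?_
    simp only [Φ]
    rw [← ENNReal.ofReal_mul (by positivity)]
    refine congrArg₂ (· * ·) (congrArg ENNReal.ofReal ?_) rfl
    rw [show q - 3 = (q - 1) - (2 : ℕ) by push_cast; ring, Real.rpow_sub_natCast hα.ne']
    ring
  have hinner : ∀ y, ∫⁻ α in Set.Ioi (0 : ℝ), Φ α y
      ≤ ENNReal.ofReal (4 * B * 2 ^ (q - 2) / (q - 2) * N ^ (q - 2))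
        * ENNReal.ofReal (‖f y‖ ^ p) := by
    intro y
    rcases (norm_nonneg (f y)).eq_or_lt with h0 | h0
    · have h0' : f y = 0 := norm_eq_zero.1 h0.symm
      have : ∀ α, Φ α y = 0 := by
        intro α
        simp only [Φ]
        by_cases h : (α, y) ∈ D <;> simp [h, h0']
      simp [this]
    -- For fixed `y` the truncation restricts `α` to `(0, b]`, where `α ^ (q - 3)` is integrable
    -- because `q > 2`. The result contains `b ^ (q - 2)`, and `(p - 1) * (q - 2) = 2 - p` turns `‖f
    -- y‖ ^ 2` into `‖f y‖ ^ p`.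
    · set b : ℝ := 2 * N / ‖f y‖ ^ (p - 1) with hb
      have hfp : 0 < ‖f y‖ ^ (p - 1) := Real.rpow_pos_of_pos h0 _
      have hb0 : 0 < b := by positivity
      have h1 : ∀ α, Φ α y = (Set.Iic b).indicator (fun α => ENNReal.ofReal (4 * B * ‖f y‖ ^ 2)
          * ENNReal.ofReal (α ^ (q - 3))) α := by
        intro α
        have hiff : (α, y) ∈ D ↔ α ∈ Set.Iic b := by
          simp only [D, Set.mem_ofPred_eq, Set.mem_Iic, hb]
          rw [le_div_iff₀ hfp]
        simp only [Φ]
        by_cases h : (α, y) ∈ D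
        · rw [Set.indicator_of_mem h, Set.indicator_of_mem (hiff.1 h), ← ofReal_norm,
            ← ENNReal.ofReal_pow (norm_nonneg _), ENNReal.ofReal_mul (by positivity : 0 ≤ 4 * B)]
          ring
        · rw [Set.indicator_of_notMem h, Set.indicator_of_notMem (fun h' => h (hiff.2 h')), mul_zero]
      simp only [h1]
      rw [lintegral_indicator measurableSet_Iic, Measure.restrict_restrict measurableSet_Iic,
        Set.inter_comm, Set.Ioi_inter_Iic, lintegral_const_mul' _ _ (by finiteness),
        lintegral_Ioc_rpow hb0.le (by linarith), ← ENNReal.ofReal_mul (by positivity),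
        ← ENNReal.ofReal_mul (by positivity [sub_pos.2 hq2])]
      refine ENNReal.ofReal_le_ofReal (le_of_eq ?_)
      rw [show q - 3 + 1 = q - 2 by ring, hb, Real.div_rpow (by positivity) hfp.le,
        Real.mul_rpow (by norm_num) hN.le, ← Real.rpow_mul h0.le,
        show (p - 1) * (q - 2) = 2 - p by linarith]
      have h2 : ‖f y‖ ^ 2 = ‖f y‖ ^ p * ‖f y‖ ^ (2 - p) := by
        rw [← Real.rpow_add h0, ← Real.rpow_natCast]
        congr 1
        push_cast
        ring
      have h3 : 0 < ‖f y‖ ^ (2 - p) := Real.rpow_pos_of_pos h0 _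
      rw [h2]
      field_simp
  have hq20 : 0 < q - 2 := sub_pos.2 hq2
  calc ENNReal.ofReal q * ∫⁻ α in Set.Ioi 0, μ {x | α < ‖∫ y, f y * K x y ∂ν‖}
        * ENNReal.ofReal (α ^ (q - 1))
      ≤ ENNReal.ofReal q * ∫⁻ α in Set.Ioi 0, (∫⁻ y, Φ α y ∂ν) := by
        gcongr ENNReal.ofReal q * ?_
        exact setLIntegral_mono' measurableSet_Ioi hdist
    _ = ENNReal.ofReal q * ∫⁻ y, (∫⁻ α in Set.Ioi 0, Φ α y) ∂ν := by
        rw [lintegral_lintegral_swap hΦ.aemeasurable]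
    _ ≤ ENNReal.ofReal q * (ENNReal.ofReal (4 * B * 2 ^ (q - 2) / (q - 2) * N ^ (q - 2))
          * ENNReal.ofReal N) := by
        gcongr ENNReal.ofReal q * ?_
        refine (lintegral_mono hinner).trans ?_
        rw [lintegral_const_mul' _ _ (by finiteness)]
        gcongr
    _ = _ := by
        rw [← ENNReal.ofReal_mul (by positivity), ← ENNReal.ofReal_mul (by positivity)]
        congr 1
        rw [show q - 1 = (q - 2) + 1 by ring, Real.rpow_add_one hN.ne']
        ring

/-! ### Extension by density. -/

/-- An operator that is defined on integrable functions and bounded from `L¹ ∩ L^p` with the norm of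
`L^p` to `L^q` has a continuous extension to `L^p`, unique already given its values on
`L¹ ∩ L² ∩ L^p`. -/
theorem exists_continuousLinearMap_extension {X Y : Type*} [MeasurableSpace X] [MeasurableSpace Y]
    {μ : Measure X} {ν : Measure Y} {p q : ℝ≥0∞} [Fact (1 ≤ p)] [Fact (1 ≤ q)] (hp : p ≠ ∞)
    {Φ : (Y → ℂ) → X → ℂ} (hcongr : ∀ f g, f =ᵐ[ν] g → Φ f = Φ g)
    (hadd : ∀ f g, Integrable f ν → Integrable g ν → Φ (f + g) = Φ f + Φ g)
    (hsmul : ∀ (a : ℂ) f, Integrable f ν → Φ (a • f) = a • Φ f) {c : ℝ}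
    (hmem : ∀ f, Integrable f ν → MemLp f p ν → MemLp (Φ f) q μ)
    (hbd : ∀ f, Integrable f ν → MemLp f p ν →
      eLpNorm (Φ f) q μ ≤ ENNReal.ofReal c * eLpNorm f p ν) (hc : 0 ≤ c) :
    ∃ T : Lp ℂ p ν →L[ℂ] Lp ℂ q μ,
      (∀ (f : Y → ℂ) (hf : MemLp f p ν), Integrable f ν → T (hf.toLp f) =ᵐ[μ] Φ f) ∧
      (∀ f, ‖T f‖ ≤ c * ‖f‖) ∧
      ∀ S : Lp ℂ p ν →L[ℂ] Lp ℂ q μ,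
        (∀ (f : Y → ℂ) (hf : MemLp f p ν), Integrable f ν → MemLp f 2 ν →
          S (hf.toLp f) =ᵐ[μ] Φ f) → S = T := by
  have hp0 : p ≠ 0 := (zero_lt_one.trans_le (Fact.out : 1 ≤ p)).ne'
  -- The domain is all integrable classes, not just the simple functions, so that the extension
  -- agrees with `Φ` on the whole of `L¹ ∩ L^p`.
  let V : Submodule ℂ (Lp ℂ p ν) :=
    { carrier := {u | Integrable u ν}
      add_mem' := fun {u v} hu hv => (hu.add hv).congr (Lp.coeFn_add u v).symm
      zero_mem' := (integrable_zero Y ℂ ν).congr (Lp.coeFn_zero ℂ p ν).symm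
      smul_mem' := fun a u hu => (hu.smul a).congr (Lp.coeFn_smul a u).symm }
  let F : V →ₗ[ℂ] Lp ℂ q μ :=
    { toFun := fun u => (hmem u.1 u.2 (Lp.memLp u.1)).toLp (Φ u.1)
      map_add' := by
        intro u v
        rw [← MemLp.toLp_add]
        congr 1
        rw [← hadd _ _ u.2 v.2]
        exact hcongr _ _ (Lp.coeFn_add u.1 v.1)
      map_smul' := by
        intro a u
        rw [RingHom.id_apply, ← MemLp.toLp_const_smul]
        congr 1
        rw [← hsmul _ _ u.2]
        exact hcongr _ _ (Lp.coeFn_smul a u.1) }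
  have hF : ∀ u : V, ‖F u‖ ≤ c * ‖V.subtype u‖ := by
    intro u
    have h := hbd u.1 u.2 (Lp.memLp u.1)
    change ‖(hmem u.1 u.2 (Lp.memLp u.1)).toLp (Φ u.1)‖ ≤ c * ‖u.1‖
    rw [Lp.norm_toLp, Lp.norm_def]
    refine (ENNReal.toReal_mono (ENNReal.mul_ne_top ENNReal.ofReal_ne_top
      (Lp.memLp u.1).eLpNorm_ne_top) h).trans_eq ?_
    rw [ENNReal.toReal_mul, ENNReal.toReal_ofReal hc]
  have hsimple : ∀ g : SimpleFunc Y ℂ, MemLp g p ν → Integrable g ν :=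
    fun g hg => (SimpleFunc.memLp_iff_integrable hp0 hp).1 hg
  have hdense : DenseRange V.subtype := by
    have h : Dense (V : Set (Lp ℂ p ν)) := by
      refine (Lp.simpleFunc.dense (E := ℂ) (μ := ν) hp).mono fun u hu => ?_
      have h1 := hsimple _ (Lp.simpleFunc.memLp (⟨u, hu⟩ : Lp.simpleFunc ℂ p ν))
      exact h1.congr (Lp.simpleFunc.toSimpleFunc_eq_toFun (⟨u, hu⟩ : Lp.simpleFunc ℂ p ν))
    simpa [DenseRange] using h
  have hT : ∀ (f : Y → ℂ) (hf : MemLp f p ν), Integrable f ν →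
      F.extendOfNorm V.subtype (hf.toLp f) =ᵐ[μ] Φ f := by
    intro f hf hfi
    have h1 : Integrable (hf.toLp f) ν := hfi.congr hf.coeFn_toLp.symm
    have h2 := LinearMap.extendOfNorm_eq hdense ⟨c, hF⟩ (⟨hf.toLp f, h1⟩ : V)
    change F.extendOfNorm V.subtype (hf.toLp f) = F ⟨hf.toLp f, h1⟩ at h2
    rw [h2, ← hcongr _ _ hf.coeFn_toLp]
    exact (hmem _ h1 (Lp.memLp _)).coeFn_toLp
  refine ⟨F.extendOfNorm V.subtype, hT, LinearMap.norm_extendOfNorm_apply_le hdense c hF, ?_⟩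
  -- Simple functions in `L^p` are integrable and square integrable and already dense, so values on
  -- `L¹ ∩ L² ∩ L^p` determine `S`.
  intro S hS
  refine ContinuousLinearMap.coeFn_injective (Continuous.ext_on (Lp.simpleFunc.dense (E := ℂ)
    (μ := ν) hp) S.continuous (ContinuousLinearMap.continuous _) fun u hu => ?_)
  set g := Lp.simpleFunc.toSimpleFunc (⟨u, hu⟩ : Lp.simpleFunc ℂ p ν)
  have hg : MemLp g p ν := Lp.simpleFunc.memLp (⟨u, hu⟩ : Lp.simpleFunc ℂ p ν)
  have hgu : hg.toLp g = u := by
    have := Lp.simpleFunc.toLp_toSimpleFunc (⟨u, hu⟩ : Lp.simpleFunc ℂ p ν)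
    exact congrArg Subtype.val this
  have hgi := hsimple g hg
  have hg2 : MemLp g 2 ν :=
    (SimpleFunc.memLp_iff_integrable two_ne_zero ENNReal.ofNat_ne_top).2 hgi
  rw [← hgu]
  exact Lp.ext ((hS g hg hgi hg2).trans (hT g hg hgi).symm)

/-! ### The `L^p` estimates for the transform. -/

/-- Interpolated `L^p → L^q` bound for an integral operator with kernel bounded by `1`, from
`L¹ → L^∞` and `L² → L²`, on integrable functions and for `1 < p < 2`. -/
theorem eLpNorm_integral_mul_kernel_le {X Y : Type*} [MeasurableSpace X]
    [MeasurableSpace Y] {μ : Measure X} {ν : Measure Y} [SFinite ν] {K : X → Y → ℂ}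
    (hK : Measurable (Function.uncurry K)) (hK1 : ∀ x y, ‖K x y‖ ≤ 1) {B : ℝ} (hB : 0 ≤ B)
    (hL2 : ∀ f : Y → ℂ, Measurable f → Integrable f ν →
      ∫⁻ x, ‖∫ y, f y * K x y ∂ν‖ₑ ^ 2 ∂μ ≤ ENNReal.ofReal B * ∫⁻ y, ‖f y‖ₑ ^ 2 ∂ν)
    {p q : ℝ≥0∞} (hp1 : 1 < p) (hp2 : p < 2) (hpq : p.HolderConjugate q) :
    ∃ c : ℝ, 0 ≤ c ∧ ∀ f : Y → ℂ, Measurable f → Integrable f ν → MemLp f p ν →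
      eLpNorm (fun x => ∫ y, f y * K x y ∂ν) q μ ≤ ENNReal.ofReal c * eLpNorm f p ν := by
  have hpt : p ≠ ∞ := (hp2.trans ENNReal.ofNat_lt_top).ne
  have hp0 : p ≠ 0 := (zero_lt_one.trans hp1).ne'
  have hr1 : 1 < p.toReal := by
    rw [← ENNReal.toReal_one]
    exact (ENNReal.toReal_lt_toReal ENNReal.one_ne_top hpt).2 hp1
  have hr2 : p.toReal < 2 := by
    rw [← ENNReal.toReal_ofNat]
    exact (ENNReal.toReal_lt_toReal hpt ENNReal.ofNat_ne_top).2 hp2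
  have hconj : p.toReal.HolderConjugate q.toReal := ENNReal.HolderConjugate.toReal hr1
  set r := p.toReal with hr
  set s := q.toReal with hs
  have hs0 : 0 < s := hconj.symm.pos
  have hmul : (r - 1) * s = r := hconj.sub_one_mul_conj
  have hs2 : 0 < s - 2 := by nlinarith
  have hq0 : q ≠ 0 := by
    rintro rfl
    simp [hs] at hs0
  have hqt : q ≠ ∞ := by
    rintro rfl
    simp [hs] at hs0
  set C : ℝ := s * (4 * B) * 2 ^ (s - 2) / (s - 2) with hC
  have hC0 : 0 ≤ C := by positivity
  refine ⟨C ^ (1 / s), by positivity, fun f hfm hf hfp => ?_⟩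
  have hN : eLpNorm f p ν = ENNReal.ofReal (eLpNorm f p ν).toReal :=
    (ENNReal.ofReal_toReal hfp.eLpNorm_ne_top).symm
  rcases eq_or_ne (eLpNorm f p ν) 0 with h0 | h0
  · have hf0 : f =ᵐ[ν] 0 := (eLpNorm_eq_zero_iff hfm.aestronglyMeasurable hp0).1 h0
    have : (fun x => ∫ y, f y * K x y ∂ν) = fun _ => 0 := by
      funext x
      refine integral_eq_zero_of_ae ?_
      filter_upwards [hf0] with y hy
      simp [hy]
    rw [this]
    simp
  · set A := (eLpNorm f p ν).toReal with hA
    have hA0 : 0 < A := ENNReal.toReal_pos h0 hfp.eLpNorm_ne_top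
    have hfN : ∫⁻ y, ENNReal.ofReal (‖f y‖ ^ r) ∂ν ≤ ENNReal.ofReal (A ^ r) := by
      rw [← ENNReal.ofReal_rpow_of_pos hA0, ← hN, eLpNorm_eq_lintegral_rpow_enorm_toReal hp0 hpt,
        ← ENNReal.rpow_mul, ← hr, one_div_mul_cancel hconj.pos.ne', ENNReal.rpow_one]
      refine lintegral_mono fun y => ?_
      rw [← ofReal_norm, ENNReal.ofReal_rpow_of_nonneg (norm_nonneg _) hconj.pos.le]
    have h := lintegral_rpow_norm_integral_mul_kernel_le hK hK1 hB hL2 hconj hr2 hfm hf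
      (Real.rpow_pos_of_pos hA0 r) hfN
    rw [hN, ← ENNReal.ofReal_mul (by positivity), eLpNorm_eq_lintegral_rpow_enorm_toReal hq0 hqt,
      ← hs]
    -- The interpolation estimate with `N = A ^ r` is homogeneous of degree one in `A` after the
    -- `s`-th root, since `r * (s - 1) = s` for conjugate exponents.
    have h2 : C ^ (1 / s) * A = (C * (A ^ r) ^ (s - 1)) ^ (1 / s) := by
      rw [Real.mul_rpow hC0 (by positivity), ← Real.rpow_mul hA0.le, ← Real.rpow_mul hA0.le,
        show r * (s - 1) * (1 / s) = 1 by field_simp; linarith, Real.rpow_one]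
    rw [h2, ← ENNReal.ofReal_rpow_of_nonneg (by positivity) (by positivity)]
    refine ENNReal.rpow_le_rpow (le_of_eq_of_le (lintegral_congr fun x => ?_) h) (by positivity)
    rw [← ofReal_norm, ENNReal.ofReal_rpow_of_nonneg (norm_nonneg _) hs0.le]

/-- At `p = 1` the kernel bound suffices, at `p = 2` the `L²` bound; in between they are
interpolated over the one measure `ν₂`, as the kernel bound holds at every point. -/
theorem eLpNorm_integral_fanKernel_le {n : ℕ} (hn : 1 ≤ n) {p p' : ℝ≥0∞} (hp1 : 1 ≤ p)
    (hp2 : p ≤ 2) (hpp' : p.HolderConjugate p') :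
    ∃ c : ℝ, 0 ≤ c ∧ ∀ f : Heis n → ℂ, Measurable f → Integrable f → MemLp f p →
      eLpNorm (fun x => ∫ g, f g * fanKernel n x g) p' ((fanNu n p).prod volume)
        ≤ ENNReal.ofReal c * eLpNorm f p := by
  have hinv := ENNReal.HolderConjugate.inv_add_inv_eq_one p p'
  rcases hp1.eq_or_lt with rfl | hp1
  · have hp' : p' = ∞ := (ENNReal.HolderConjugate.eq_top_iff_eq_one p' 1).2 rfl
    subst hp'
    refine ⟨1, zero_le_one, fun f hfm hf _ => ?_⟩
    rw [eLpNorm_exponent_top, eLpNorm_one_eq_lintegral_enorm, ENNReal.ofReal_one, one_mul]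
    refine essSup_le_of_ae_le _ (Filter.Eventually.of_forall fun x => ?_)
    refine (enorm_integral_le_lintegral_enorm _).trans (lintegral_mono fun g => ?_)
    rw [enorm_mul]
    refine mul_le_of_le_one_right' ?_
    rw [← ofReal_norm, ← ENNReal.ofReal_one]
    exact ENNReal.ofReal_le_ofReal (norm_fanKernel_le hn x g)
  have hnu : fanNu n p = fanMeasure n (fanWeightTwo n) := by
    rw [fanNu, if_neg hp1.ne']
  rw [hnu]
  rcases hp2.eq_or_lt with rfl | hp2
  · have hp' : p' = 2 := by
      rw [← inv_inj, ← ENNReal.add_right_inj (ENNReal.inv_ne_top.2 two_ne_zero), hinv,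
        ENNReal.inv_two_add_inv_two]
    subst hp'
    refine ⟨(2 ^ n : ℝ) ^ (1 / 2 : ℝ), by positivity, fun f hfm hf _ => ?_⟩
    rw [eLpNorm_eq_lintegral_rpow_enorm_toReal two_ne_zero ENNReal.ofNat_ne_top,
      eLpNorm_eq_lintegral_rpow_enorm_toReal two_ne_zero ENNReal.ofNat_ne_top,
      ENNReal.toReal_ofNat, ← ENNReal.ofReal_rpow_of_nonneg (by positivity) (by positivity),
      ← ENNReal.mul_rpow_of_nonneg _ _ (by positivity)]
    refine ENNReal.rpow_le_rpow ?_ (by positivity)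
    simpa only [ENNReal.rpow_ofNat] using lintegral_integral_fanKernel_sq_le hn hfm hf
  · exact eLpNorm_integral_mul_kernel_le (measurable_fanKernel n) (norm_fanKernel_le hn)
      (by positivity : (0 : ℝ) ≤ 2 ^ n) (fun f hfm hf => lintegral_integral_fanKernel_sq_le hn hfm hf)
      hp1 hp2 hpp'

/-- Replacing `f` by a measurable representative changes the integral at no point `x`. -/
theorem aestronglyMeasurable_integral_fanKernel {n : ℕ} {f : Heis n → ℂ} (hf : Integrable f)
    (μ : Measure (heisFan n × (Fin n → ℂ))) :
    AEStronglyMeasurable (fun x => ∫ g, f g * fanKernel n x g) μ := by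
  have h : StronglyMeasurable fun q : (heisFan n × (Fin n → ℂ)) × Heis n =>
      hf.1.mk f q.2 * Function.uncurry (fanKernel n) q :=
    ((hf.1.stronglyMeasurable_mk.measurable.comp measurable_snd).mul
      (measurable_fanKernel n)).stronglyMeasurable
  have h2 : (fun x => ∫ g, f g * fanKernel n x g) = fun x => ∫ g, hf.1.mk f g * fanKernel n x g := by
    funext x
    refine integral_congr_ae ?_
    filter_upwards [hf.1.ae_eq_mk] with g hg
    rw [hg]
  rw [h2]
  exact h.integral_prod_right.aestronglyMeasurable

theorem integrable_mul_fanKernel {n : ℕ} (hn : 1 ≤ n) {f : Heis n → ℂ} (hf : Integrable f)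
    (x : heisFan n × (Fin n → ℂ)) : Integrable fun g => f g * fanKernel n x g :=
  hf.mul_bdd ((measurable_fanKernel n).comp measurable_prodMk_left).aestronglyMeasurable
    (Filter.Eventually.of_forall (norm_fanKernel_le hn x))

end

theorem theorem1p4 (n : ℕ) (hn : 1 ≤ n) (p p' : ℝ≥0∞) [Fact (1 ≤ p)] [Fact (1 ≤ p')]
    (hp : p ≤ 2) (hpp' : p.HolderConjugate p') :
    ∃ c : ℝ, 0 ≤ c ∧
      -- for integrable `f` in `L^p`, where the transform is given by its integral formula
      (∀ f : Heis n → ℂ, Integrable f → MemLp f p →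
        MemLp (fun x : heisFan n × (Fin n → ℂ) => strichartzTilde n f x.1 x.2) p'
            ((fanNu n p).prod volume) ∧
        eLpNorm (fun x : heisFan n × (Fin n → ℂ) => strichartzTilde n f x.1 x.2) p'
            ((fanNu n p).prod volume) ≤ ENNReal.ofReal c * eLpNorm f p volume) ∧
      -- for all `f` in `L^p`, where the transform is the continuous extension `T`
      ∃ T : Lp ℂ p (volume : Measure (Heis n)) →L[ℂ] Lp ℂ p' ((fanNu n p).prod volume),
        (∀ (f : Heis n → ℂ) (hf : MemLp f p volume), Integrable f →
          T (hf.toLp f) =ᵐ[(fanNu n p).prod volume] fun x => strichartzTilde n f x.1 x.2) ∧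
        (∀ f, ‖T f‖ ≤ c * ‖f‖) ∧
        -- the extension is the only one from `L¹ ∩ L²`
        (∀ S : Lp ℂ p (volume : Measure (Heis n)) →L[ℂ] Lp ℂ p' ((fanNu n p).prod volume),
          (∀ (f : Heis n → ℂ) (hf : MemLp f p volume), Integrable f → MemLp f 2 volume →
            S (hf.toLp f) =ᵐ[(fanNu n p).prod volume] fun x => strichartzTilde n f x.1 x.2) →
          S = T) := by
  obtain ⟨c, hc, hbound⟩ := eLpNorm_integral_fanKernel_le hn (Fact.out : 1 ≤ p) hp hpp'
  have hpt : p ≠ ∞ := (hp.trans_lt ENNReal.ofNat_lt_top).ne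
  -- The kernel formula is used at every point. It can differ from `strichartzTilde` only on the
  -- null set `lam = 0`, and it is linear on integrable functions and respects almost everywhere
  -- equality at each single point.
  let Φ : (Heis n → ℂ) → heisFan n × (Fin n → ℂ) → ℂ := fun f x => ∫ g, f g * fanKernel n x g
  have hae : ∀ f : Heis n → ℂ, (fun x : heisFan n × (Fin n → ℂ) => strichartzTilde n f x.1 x.2)
      =ᵐ[(fanNu n p).prod volume] Φ f := strichartzTilde_ae_eq n p
  have hcongr : ∀ f g : Heis n → ℂ, f =ᵐ[volume] g → Φ f = Φ g := by
    intro f g hfg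
    funext x
    refine integral_congr_ae ?_
    filter_upwards [hfg] with y hy
    rw [hy]
  have hbd : ∀ f : Heis n → ℂ, Integrable f → MemLp f p →
      eLpNorm (Φ f) p' ((fanNu n p).prod volume) ≤ ENNReal.ofReal c * eLpNorm f p volume := by
    intro f hf hfp
    have hmk := hf.1.ae_eq_mk
    rw [hcongr _ _ hmk, eLpNorm_congr_ae hmk]
    exact hbound _ hf.1.stronglyMeasurable_mk.measurable (hf.congr hmk) (hfp.ae_eq hmk)
  have hmem : ∀ f : Heis n → ℂ, Integrable f → MemLp f p →
      MemLp (Φ f) p' ((fanNu n p).prod volume) := fun f hf hfp =>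
    ⟨aestronglyMeasurable_integral_fanKernel hf _,
      (hbd f hf hfp).trans_lt (ENNReal.mul_lt_top ENNReal.ofReal_lt_top hfp.2)⟩
  obtain ⟨T, hT, hTn, hTu⟩ := exists_continuousLinearMap_extension
    (μ := (fanNu n p).prod (volume : Measure (Fin n → ℂ))) (q := p') hpt hcongr
    (fun f g hf hg => by
      funext x
      simp only [Φ, Pi.add_apply, add_mul]
      exact integral_add (integrable_mul_fanKernel hn hf x) (integrable_mul_fanKernel hn hg x))
    (fun a f _ => by
      funext x
      simp only [Φ, Pi.smul_apply, smul_eq_mul, mul_assoc]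
      exact integral_const_mul a _) hmem hbd hc
  refine ⟨c, hc, fun f hf hfp => ⟨(hmem f hf hfp).ae_eq (hae f).symm, ?_⟩, T,
    fun f hf hfi => (hT f hf hfi).trans (hae f).symm, hTn, fun S hS => hTu S fun f hf hfi hf2 =>
      (hS f hf hfi hf2).trans (hae f)⟩
  rw [eLpNorm_congr_ae (hae f)]
  exact hbd f hf hfp
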